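/- Let $(y(k))_{k\in\mathbb Z}$ be a zero-mean, wide-sense stationary, real Gaussian process with autocorrelation function $C(\tau)=\mathbb E[y(k)y(k-\tau)]$, let $\delta\ge 1$ be an integer, and let $x(n)=(x_1(n),x_2(n))^T=(y(n\delta+1),y(n\delta+2))^T$. Write $C_j=C(j)$ and $\gamma_i=\gamma_i(\tau)=C(\tau\delta+i)$ for $i\in\{-1,0,1\}$. Assume that the covariance matrix of $x(n)$ is invertible, i.e. $C_0^2-C_1^2\ne 0$, and that the mixing condition holds: $\sum_{\tau=0}^{\infty}S_{ab}(\tau)^2<\infty$ for all $a,b\in\{1,2\}$, where $S_{ab}(\tau)=\mathbb E[x_a(n+\tau)x_b(n)]=C(\tau\delta+a-b)$. For $N\ge1$ let $$\hat S=\frac1N\sum_{k=1}^N x(k)x(k)^T,\qquad \hat B_2=\hat B_2(N)=\frac1N\sum_{n=1}^N\big(x(n)^T\hat S^{-1}x(n)\big)^2$$ be Mardia's sample kurtosis (where $\hat S$ is singular, $\hat S^{-1}$ is read as $0$). Then $\hat B_2(N)$ is square integrable for every $N$, and, as $N\to\infty$, $$\mathbb E[\hat B_2]=8-\frac{16}{N}-\frac{4}{N^2}\sum_{\tau=1}^{N-1}\frac{(N-\tau)\,q_1(\tau)}{(C_0^2-C_1^2)^2}+o\!\left(\frac1N\right),$$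 $$\operatorname{Var}(\hat B_2)=\frac{64}{N}+\frac{16}{N^2}\sum_{\tau=1}^{N-1}\frac{(N-\tau)\,q_2(\tau)}{(C_0^2-C_1^2)^4}+o\!\left(\frac1N\right),$$ where $$q_1(\tau)=\big[(\gamma_1+\gamma_{-1})^2+8\gamma_0^2\big]C_0^2-12\,C_0C_1\,\gamma_0(\gamma_1+\gamma_{-1})+\big[2(\gamma_1+\gamma_{-1})^2+4\gamma_0^2\big]C_1^2,$$ $$\begin{aligned}q_2(\tau)={}&\big[8(\gamma_0^2-\gamma_1\gamma_{-1})^2+3(\gamma_1^2-\gamma_{-1}^2)^2+12\gamma_0^2(\gamma_1+\gamma_{-1})^2\big]C_0^4\\&+4\big[8\gamma_0^4+3(5\gamma_0^2+\gamma_1\gamma_{-1})(\gamma_1+\gamma_{-1})^2-4\gamma_1\gamma_{-1}(\gamma_0^2+\gamma_1\gamma_{-1})\big]C_0^2C_1^2\\&+8\big[\gamma_0^4+4\gamma_0^2\gamma_1\gamma_{-1}+\gamma_1^2\gamma_{-1}^2\big]C_1^4\\&-24\,C_0C_1\,\gamma_0(\gamma_1+\gamma_{-1})\big[(2\gamma_0^2+\gamma_1^2+\gamma_{-1}^2)C_0^2+2(\gamma_0^2+\gamma_1\gamma_{-1})C_1^2\big].\end{aligned}$$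 -/

import Mathlib

open MeasureTheory ProbabilityTheory Filter Asymptotics
open scoped Matrix

noncomputable section

/-- The time embedding `x(n) = (y(nδ + 1), …, y(nδ + p))` of a scalar process `y`
(the coordinates are numbered from `0` to `p - 1`, hence the shift `a + 1`). -/
def timeEmbedding {Ω : Type*} (p δ : ℕ) (y : ℤ → Ω → ℝ) (n : ℤ) (ω : Ω) : Fin p → ℝ :=
  fun a => y (n * (δ : ℤ) + ((a : ℕ) : ℤ) + 1) ω

/-- The matrix `S(τ)` with entries `S_ab(τ) = E[x_a(τ) x_b(0)]` of lagged second moments of a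
(zero-mean, wide-sense stationary) vector process `x`. -/
def laggedCov {Ω : Type*} [MeasurableSpace Ω] {p : ℕ} (μ : Measure Ω)
    (x : ℤ → Ω → Fin p → ℝ) (τ : ℤ) : Matrix (Fin p) (Fin p) ℝ :=
  Matrix.of fun a b => ∫ ω, x τ ω a * x 0 ω b ∂μ

/-- The mixing condition: `∑_{τ ≥ 0} |S_ab(τ)|²` converges for all `a, b`. -/
def IsMixing {Ω : Type*} [MeasurableSpace Ω] {p : ℕ} (μ : Measure Ω)
    (x : ℤ → Ω → Fin p → ℝ) : Prop :=
  ∀ a b : Fin p, Summable fun τ : ℕ => |laggedCov μ x (τ : ℤ) a b| ^ 2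

/-- The sample covariance `Ŝ = (1/N) ∑_{k=1}^N x(k) x(k)ᵀ`. -/
def sampleCov {Ω : Type*} {p : ℕ} (x : ℤ → Ω → Fin p → ℝ) (N : ℕ) (ω : Ω) :
    Matrix (Fin p) (Fin p) ℝ :=
  (1 / (N : ℝ)) • ∑ k ∈ Finset.Icc 1 N, Matrix.vecMulVec (x (k : ℤ) ω) (x (k : ℤ) ω)

/-- Mardia's sample multivariate kurtosis
`B̂_p(N) = (1/N) ∑_{n=1}^N (x(n)ᵀ Ŝ⁻¹ x(n))²`. -/
def mardiaKurtosis {Ω : Type*} {p : ℕ} (x : ℤ → Ω → Fin p → ℝ) (N : ℕ) (ω : Ω) : ℝ :=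
  (1 / (N : ℝ)) *
    ∑ n ∈ Finset.Icc 1 N, (x (n : ℤ) ω ⬝ᵥ ((sampleCov x N ω)⁻¹ *ᵥ x (n : ℤ) ω)) ^ 2

/-- `γ_i(τ) = C(τδ + i)`. -/
def gammaCoeff (C : ℤ → ℝ) (δ : ℕ) (i : ℤ) (τ : ℕ) : ℝ :=
  C ((τ : ℤ) * (δ : ℤ) + i)

/-- The polynomial `q₁`, in `a = C₀`, `b = C₁`, `gm = γ₋₁`, `g0 = γ₀`, `gp = γ₁`. -/
def q₁Poly (a b gm g0 gp : ℝ) : ℝ :=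
  ((gp + gm) ^ 2 + 8 * g0 ^ 2) * a ^ 2
    - 12 * a * b * g0 * (gp + gm)
    + (2 * (gp + gm) ^ 2 + 4 * g0 ^ 2) * b ^ 2

/-- The polynomial `q₂`, in `a = C₀`, `b = C₁`, `gm = γ₋₁`, `g0 = γ₀`, `gp = γ₁`. -/
def q₂Poly (a b gm g0 gp : ℝ) : ℝ :=
  (8 * (g0 ^ 2 - gp * gm) ^ 2 + 3 * (gp ^ 2 - gm ^ 2) ^ 2
      + 12 * g0 ^ 2 * (gp + gm) ^ 2) * a ^ 4
    + 4 * (8 * g0 ^ 4 + 3 * (5 * g0 ^ 2 + gp * gm) * (gp + gm) ^ 2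
      - 4 * gp * gm * (g0 ^ 2 + gp * gm)) * a ^ 2 * b ^ 2
    + 8 * (g0 ^ 4 + 4 * g0 ^ 2 * gp * gm + gp ^ 2 * gm ^ 2) * b ^ 4
    - 24 * a * b * g0 * (gp + gm) *
      ((2 * g0 ^ 2 + gp ^ 2 + gm ^ 2) * a ^ 2 + 2 * (g0 ^ 2 + gp * gm) * b ^ 2)

/-- `q₁(τ)` for the autocorrelation function `C` and the embedding step `δ`. -/
def q₁ (C : ℤ → ℝ) (δ τ : ℕ) : ℝ :=
  q₁Poly (C 0) (C 1) (gammaCoeff C δ (-1) τ) (gammaCoeff C δ 0 τ) (gammaCoeff C δ 1 τ)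

/-- `q₂(τ)` for the autocorrelation function `C` and the embedding step `δ`. -/
def q₂ (C : ℤ → ℝ) (δ τ : ℕ) : ℝ :=
  q₂Poly (C 0) (C 1) (gammaCoeff C δ (-1) τ) (gammaCoeff C δ 0 τ) (gammaCoeff C δ 1 τ)

end

open Polynomial

/-!
Mardia's kurtosis is invariant under an invertible linear change of the data, so the covariance may
be taken to be the identity. With `Ŝ = 1 + Δ`, the second-order expansion of `Ŝ⁻¹` in `Δ` turns the
kurtosis into `8` plus a linear combination of time averages of fourth Wick powers, minus a
quadratic form in time averages of second Wick powers, plus products of the two kinds, all taken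
along finitely many directions. By Wick orthogonality the mean of such a product vanishes, and the
other moments are averages over lags of powers of the lagged covariances of the directions.

A centred quadratic form in Gaussian variables with bounded Frobenius norm has exponential moments,
so the even moment of order `2m` of the entries of `Δ` is `O(N⁻ᵐ)`. This controls the third-order
remainder. On the rare event that `Δ` is not small, where `Ŝ` may even be singular, the crude
deterministic bound `B̂_p ≤ p²N` suffices.
-/

section Moments

variable {Ω : Type*} [MeasurableSpace Ω] {μ : Measure Ω} {f g : Ω → ℝ}

/-- A real random variable lies in `Lᵖ` for every finite exponent `p`. Natural exponents suffice
for the closure properties below. -/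
def HasAllMoments (f : Ω → ℝ) (μ : Measure Ω) : Prop :=
  ∀ p : ℕ, MemLp f p μ

namespace HasAllMoments

lemma add (hf : HasAllMoments f μ) (hg : HasAllMoments g μ) :
    HasAllMoments (fun ω => f ω + g ω) μ := fun p => (hf p).add (hg p)

lemma sub (hf : HasAllMoments f μ) (hg : HasAllMoments g μ) :
    HasAllMoments (fun ω => f ω - g ω) μ := fun p => (hf p).sub (hg p)

lemma const_mul (hf : HasAllMoments f μ) (c : ℝ) :
    HasAllMoments (fun ω => c * f ω) μ := fun p => (hf p).const_mul c

lemma const [IsFiniteMeasure μ] (c : ℝ) : HasAllMoments (fun _ => c) μ := fun _ => memLp_const c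

lemma sum {ι : Type*} (s : Finset ι) {f : ι → Ω → ℝ} (hf : ∀ i ∈ s, HasAllMoments (f i) μ) :
    HasAllMoments (fun ω => ∑ i ∈ s, f i ω) μ := fun p =>
  memLp_finsetSum s fun i hi => hf i hi p

lemma mul (hf : HasAllMoments f μ) (hg : HasAllMoments g μ) :
    HasAllMoments (fun ω => f ω * g ω) μ := fun p => by
  have : ENNReal.HolderTriple ((2 * p : ℕ) : ENNReal) ((2 * p : ℕ) : ENNReal) p := ⟨by
    push_cast
    rw [ENNReal.mul_inv (by simp) (by simp), ← add_mul, ENNReal.inv_two_add_inv_two, one_mul]⟩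
  exact (hg (2 * p)).mul (hf (2 * p))

lemma pow [IsFiniteMeasure μ] (hf : HasAllMoments f μ) (n : ℕ) :
    HasAllMoments (fun ω => f ω ^ n) μ := by
  induction n with
  | zero => simpa using const (μ := μ) 1
  | succ n ih => simpa only [pow_succ] using ih.mul hf

lemma polynomial_eval [IsFiniteMeasure μ] (hf : HasAllMoments f μ) (q : ℝ[X]) :
    HasAllMoments (fun ω => q.eval (f ω)) μ := by
  simp only [eval_eq_sum, sum_def]
  exact sum _ fun n _ => (hf.pow n).const_mul _

lemma norm_pi {ι : Type*} [Fintype ι] {F : Ω → ι → ℝ} (hF : ∀ i, HasAllMoments (fun ω => F ω i) μ) :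
    HasAllMoments (fun ω => ‖F ω‖) μ := fun p =>
  (memLp_pi_iff.2 fun i => hF i p).norm

lemma integrable (hf : HasAllMoments f μ) : Integrable f μ := by
  simpa only [Nat.cast_one, memLp_one_iff_integrable] using hf 1

lemma memLp_two (hf : HasAllMoments f μ) : MemLp f 2 μ := mod_cast hf 2

end HasAllMoments

lemma hasAllMoments_of_hasGaussianLaw (hf : HasGaussianLaw f μ) : HasAllMoments f μ :=
  fun _ => hf.memLp (by simp)

end Moments

section IntegrationByParts

lemma hasAllMoments_id_gaussianReal (v : NNReal) : HasAllMoments (fun x => x) (gaussianReal 0 v) :=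
  fun p => memLp_id_gaussianReal' p (by simp)

lemma integrable_eval_gaussianReal (v : NNReal) (q : ℝ[X]) :
    Integrable (fun x => q.eval x) (gaussianReal 0 v) :=
  ((hasAllMoments_id_gaussianReal v).polynomial_eval q).integrable

lemma hasDerivAt_gaussianPDFReal (m : ℝ) (v : NNReal) (x : ℝ) :
    HasDerivAt (gaussianPDFReal m v) (-((x - m) / v) * gaussianPDFReal m v x) x := by
  have h : HasDerivAt (fun x : ℝ => -(x - m) ^ 2 / (2 * v)) (-((x - m) / v)) x := by
    refine ((((hasDerivAt_id x).sub_const m).pow 2).neg.div_const (2 * (v : ℝ))).congr_deriv ?_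
    simp only [id, Nat.cast_ofNat, Nat.add_one_sub_one, pow_one, mul_one]
    rw [neg_div, mul_div_mul_left _ _ two_ne_zero]
  rw [gaussianPDFReal_def]
  exact (h.exp.const_mul (√(2 * Real.pi * v))⁻¹).congr_deriv (by ring)

lemma integrable_eval_mul_gaussianPDFReal {v : NNReal} (hv : v ≠ 0) (q : ℝ[X]) :
    Integrable fun x => q.eval x * gaussianPDFReal 0 v x := by
  have h := integrable_eval_gaussianReal v q
  rw [gaussianReal_of_var_ne_zero _ hv, integrable_withDensity_iff (by fun_prop)
    (by simp [gaussianPDF])] at h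
  simpa only [toReal_gaussianPDF] using h

lemma integral_mul_eval_gaussianReal (v : NNReal) (q : ℝ[X]) :
    ∫ x, x * q.eval x ∂gaussianReal 0 v = v * ∫ x, q.derivative.eval x ∂gaussianReal 0 v := by
  rcases eq_or_ne v 0 with rfl | hv
  · simp
  have parts := integral_mul_deriv_eq_deriv_mul_of_integrable
    (fun x _ => q.hasDerivAt x) (fun x _ => hasDerivAt_gaussianPDFReal 0 v x)
    (((integrable_eval_mul_gaussianPDFReal hv (q * X)).const_mul (-(v : ℝ)⁻¹)).congr
      (ae_of_all _ fun x => by simp only [Pi.mul_apply, eval_mul, eval_X]; ring))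
    (integrable_eval_mul_gaussianPDFReal hv q.derivative)
    (integrable_eval_mul_gaussianPDFReal hv q)
  have h : ∫ x, q.eval x * (-((x - 0) / v) * gaussianPDFReal 0 v x)
      = -(v : ℝ)⁻¹ * ∫ x, gaussianPDFReal 0 v x * (x * q.eval x) := by
    rw [← integral_const_mul]
    exact integral_congr_ae (ae_of_all _ fun x => by ring)
  rw [h] at parts
  simp only [integral_gaussianReal_eq_integral_smul hv, smul_eq_mul]
  simp only [mul_comm (gaussianPDFReal 0 v _) (eval _ q.derivative)]
  have hv' : (v : ℝ) ≠ 0 := mod_cast hv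
  field_simp at parts
  simp only [mul_assoc] at parts
  linarith

variable {Ω : Type*} [MeasurableSpace Ω] {μ : Measure Ω} {X : Ω → ℝ}

lemma map_eq_gaussianReal_of_integral_eq_zero (hX : HasGaussianLaw X μ) (h0 : ∫ ω, X ω ∂μ = 0) :
    μ.map X = gaussianReal 0 (∫ ω, X ω ^ 2 ∂μ).toNNReal := by
  rw [hX.map_eq_gaussianReal, variance_of_integral_eq_zero hX.aemeasurable h0, h0]

end IntegrationByParts

section Wick

/-- The Wick power `:xⁿ:` of a centred variable of variance `s`, that is the Hermite polynomial
orthogonal for the Gaussian law of variance `s`. The recursion used as definition is the one that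
matches Gaussian integration by parts. -/
noncomputable def wickPolynomial (s : ℝ) : ℕ → ℝ[X]
  | 0 => 1
  | n + 1 => X * wickPolynomial s n - C s * derivative (wickPolynomial s n)

lemma derivative_wickPolynomial_succ (s : ℝ) (n : ℕ) :
    derivative (wickPolynomial s (n + 1)) = (n + 1) * wickPolynomial s n := by
  induction n with
  | zero => simp [wickPolynomial]
  | succ n ih =>
    have h : derivative (wickPolynomial s (n + 2)) = wickPolynomial s (n + 1)
        + X * derivative (wickPolynomial s (n + 1))
        - C s * derivative (derivative (wickPolynomial s (n + 1))) := by
      rw [wickPolynomial]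
      simp
    rw [h, ih]
    simp only [derivative_mul, derivative_add, derivative_natCast, derivative_one, wickPolynomial]
    push_cast
    ring

lemma eval_wickPolynomial_two (s x : ℝ) : (wickPolynomial s 2).eval x = x ^ 2 - s := by
  simp only [wickPolynomial, derivative_mul, derivative_X, derivative_one, derivative_sub,
    derivative_zero, derivative_C, eval_sub, eval_add, eval_mul, eval_X, eval_C, eval_one,
    eval_zero]
  ring

lemma eval_wickPolynomial_four (s x : ℝ) :
    (wickPolynomial s 4).eval x = x ^ 4 - 6 * s * x ^ 2 + 3 * s ^ 2 := by
  simp only [wickPolynomial, derivative_mul, derivative_X, derivative_one, derivative_sub,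
    derivative_add, derivative_zero, derivative_C, eval_sub, eval_add, eval_mul, eval_X, eval_C,
    eval_one, eval_zero]
  ring

variable {Ω : Type*} [MeasurableSpace Ω] {μ : Measure Ω} {X Y Z : Ω → ℝ}

lemma integral_mul_eval_mul_eval_of_indepFun (hX : HasGaussianLaw X μ) (hZ : HasGaussianLaw Z μ)
    (hXZ : IndepFun X Z μ) (hX0 : ∫ ω, X ω ∂μ = 0) (c : ℝ) (p q : ℝ[X]) :
    ∫ ω, X ω * (p.eval (X ω) * q.eval (c * X ω + Z ω)) ∂μ
      = (∫ ω, X ω ^ 2 ∂μ) * ∫ ω, p.derivative.eval (X ω) * q.eval (c * X ω + Z ω)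
        + c * (p.eval (X ω) * q.derivative.eval (c * X ω + Z ω)) ∂μ := by
  have : IsProbabilityMeasure μ := hX.isProbabilityMeasure
  have mX := hasAllMoments_of_hasGaussianLaw hX
  have mS := (mX.const_mul c).add (hasAllMoments_of_hasGaussianLaw hZ)
  have law := (indepFun_iff_map_prod_eq_prod_map_map hX.aemeasurable hZ.aemeasurable).1 hXZ
  have iterated (F : ℝ × ℝ → ℝ) (hF : Continuous F) (hI : Integrable (fun ω => F (X ω, Z ω)) μ) :
      ∫ ω, F (X ω, Z ω) ∂μ = ∫ z, ∫ x, F (x, z) ∂μ.map X ∂μ.map Z := by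
    have hXZm := hX.aemeasurable.prodMk hZ.aemeasurable
    rw [← integral_map hXZm hF.aestronglyMeasurable, law, integral_prod_symm]
    rw [← law]
    exact (integrable_map_measure hF.aestronglyMeasurable hXZm).2 hI
  rw [iterated (fun w => w.1 * (p.eval w.1 * q.eval (c * w.1 + w.2))) (by fun_prop)
      (mX.mul ((mX.polynomial_eval p).mul (mS.polynomial_eval q))).integrable,
    iterated (fun w => p.derivative.eval w.1 * q.eval (c * w.1 + w.2)
      + c * (p.eval w.1 * q.derivative.eval (c * w.1 + w.2))) (by fun_prop)
      (((mX.polynomial_eval _).mul (mS.polynomial_eval q)).add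
        (((mX.polynomial_eval p).mul (mS.polynomial_eval _)).const_mul c)).integrable,
    ← integral_const_mul]
  refine integral_congr_ae (ae_of_all _ fun z => ?_)
  have parts := integral_mul_eval_gaussianReal (∫ ω, X ω ^ 2 ∂μ).toNNReal
    (p * q.comp (Polynomial.C c * Polynomial.X + Polynomial.C z))
  rw [Real.coe_toNNReal _ (integral_nonneg fun ω => sq_nonneg _),
    ← map_eq_gaussianReal_of_integral_eq_zero hX hX0] at parts
  simp only [eval_mul, eval_comp, eval_add, eval_C, eval_X, derivative_mul, derivative_comp,
    derivative_add, derivative_C, zero_mul, derivative_X, mul_one, zero_add, add_zero] at parts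
  convert parts using 4
  ring_nf

lemma ae_eq_zero_of_integral_sq_eq_zero (hX : HasAllMoments X μ) (h : ∫ ω, X ω ^ 2 ∂μ = 0) :
    X =ᵐ[μ] 0 := by
  have := (integral_eq_zero_iff_of_nonneg (fun ω => sq_nonneg (X ω))
    hX.memLp_two.integrable_sq).1 h
  filter_upwards [this] with ω hω using pow_eq_zero_iff two_ne_zero |>.1 hω

lemma integral_mul_eval_mul_eval (hXY : HasGaussianLaw (fun ω => (X ω, Y ω)) μ)
    (hX0 : ∫ ω, X ω ∂μ = 0) (p q : ℝ[X]) :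
    ∫ ω, X ω * (p.eval (X ω) * q.eval (Y ω)) ∂μ
      = (∫ ω, X ω ^ 2 ∂μ) * ∫ ω, p.derivative.eval (X ω) * q.eval (Y ω) ∂μ
        + (∫ ω, X ω * Y ω ∂μ) * ∫ ω, p.eval (X ω) * q.derivative.eval (Y ω) ∂μ := by
  have : IsProbabilityMeasure μ := hXY.isProbabilityMeasure
  have mX := hasAllMoments_of_hasGaussianLaw hXY.fst
  have mY := hasAllMoments_of_hasGaussianLaw hXY.snd
  set s := ∫ ω, X ω ^ 2 ∂μ with hs
  set r := ∫ ω, X ω * Y ω ∂μ with hr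
  rcases eq_or_ne s 0 with hs0 | hs0
  · have hX := ae_eq_zero_of_integral_sq_eq_zero mX hs0
    have vanish (f : Ω → ℝ) : ∫ ω, X ω * f ω ∂μ = 0 :=
      integral_eq_zero_of_ae (by filter_upwards [hX] with ω hω; simp [hω])
    rw [vanish, hs0, hr, vanish]
    ring
  -- `Y = c X + Z` with `Z` uncorrelated with, hence independent of, `X`.
  obtain ⟨c, hc⟩ : ∃ c, r = c * s := ⟨r / s, (div_mul_cancel₀ r hs0).symm⟩
  have hXZ : HasGaussianLaw (fun ω => (X ω, Y ω - c * X ω)) μ := by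
    simpa using hXY.map_fun ((ContinuousLinearMap.fst ℝ ℝ ℝ).prod
      (ContinuousLinearMap.snd ℝ ℝ ℝ - c • ContinuousLinearMap.fst ℝ ℝ ℝ))
  have uncorrelated : ∫ ω, X ω * (Y ω - c * X ω) ∂μ = 0 := by
    have h (ω : Ω) : X ω * (Y ω - c * X ω) = X ω * Y ω - c * X ω ^ 2 := by ring
    simp_rw [h]
    rw [integral_sub (mX.mul mY).integrable ((mX.pow 2).const_mul c).integrable,
      integral_const_mul, ← hs, ← hr, hc, sub_self]
  have hind : IndepFun X (fun ω => Y ω - c * X ω) μ := by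
    refine hXZ.indepFun_of_covariance_eq_zero ?_
    rw [covariance_eq_sub mX.memLp_two (mY.sub (mX.const_mul c)).memLp_two, hX0, zero_mul, sub_zero]
    exact uncorrelated
  have parts := integral_mul_eval_mul_eval_of_indepFun hXY.fst hXZ.snd hind hX0 c p q
  simp only [add_sub_cancel] at parts
  rw [parts, integral_add ((mX.polynomial_eval _).mul (mY.polynomial_eval _)).integrable
    (((mX.polynomial_eval _).mul (mY.polynomial_eval _)).const_mul c).integrable,
    integral_const_mul, ← hs, hc]
  ring

lemma integral_wickPolynomial_succ_mul_eval (hXY : HasGaussianLaw (fun ω => (X ω, Y ω)) μ)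
    (hX0 : ∫ ω, X ω ∂μ = 0) (n : ℕ) (q : ℝ[X]) :
    ∫ ω, (wickPolynomial (∫ ω, X ω ^ 2 ∂μ) (n + 1)).eval (X ω) * q.eval (Y ω) ∂μ
      = (∫ ω, X ω * Y ω ∂μ)
        * ∫ ω, (wickPolynomial (∫ ω, X ω ^ 2 ∂μ) n).eval (X ω) * q.derivative.eval (Y ω) ∂μ := by
  have : IsProbabilityMeasure μ := hXY.isProbabilityMeasure
  have mX := hasAllMoments_of_hasGaussianLaw hXY.fst
  have mY := hasAllMoments_of_hasGaussianLaw hXY.snd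
  set s := ∫ ω, X ω ^ 2 ∂μ with hs
  set W := wickPolynomial s n
  have recursion (ω : Ω) : (wickPolynomial s (n + 1)).eval (X ω) * q.eval (Y ω)
      = X ω * (W.eval (X ω) * q.eval (Y ω)) - s * (W.derivative.eval (X ω) * q.eval (Y ω)) := by
    simp only [wickPolynomial, eval_sub, eval_mul, eval_X, eval_C, W]
    ring
  simp_rw [recursion]
  rw [integral_sub (mX.mul ((mX.polynomial_eval _).mul (mY.polynomial_eval _))).integrable
    (((mX.polynomial_eval _).mul (mY.polynomial_eval _)).const_mul s).integrable,
    integral_const_mul, integral_mul_eval_mul_eval hXY hX0, ← hs, add_sub_cancel_left]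

lemma integral_wickPolynomial_mul_wickPolynomial (hXY : HasGaussianLaw (fun ω => (X ω, Y ω)) μ)
    (hX0 : ∫ ω, X ω ∂μ = 0) (hY0 : ∫ ω, Y ω ∂μ = 0) (m n : ℕ) :
    ∫ ω, (wickPolynomial (∫ ω, X ω ^ 2 ∂μ) m).eval (X ω)
        * (wickPolynomial (∫ ω, Y ω ^ 2 ∂μ) n).eval (Y ω) ∂μ
      = if m = n then n.factorial * (∫ ω, X ω * Y ω ∂μ) ^ n else 0 := by
  have : IsProbabilityMeasure μ := hXY.isProbabilityMeasure
  induction m generalizing n with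
  | zero =>
    cases n with
    | zero => simp [wickPolynomial]
    | succ n =>
      have hYX : HasGaussianLaw (fun ω => (Y ω, X ω)) μ := by
        simpa using hXY.map_fun
          ((ContinuousLinearMap.snd ℝ ℝ ℝ).prod (ContinuousLinearMap.fst ℝ ℝ ℝ))
      simpa [wickPolynomial, mul_comm] using integral_wickPolynomial_succ_mul_eval hYX hY0 n 1
  | succ m ih =>
    rw [integral_wickPolynomial_succ_mul_eval hXY hX0]
    cases n with
    | zero => simp [wickPolynomial]
    | succ n =>
      rw [derivative_wickPolynomial_succ]
      have scalar (ω : Ω) : (wickPolynomial (∫ ω, X ω ^ 2 ∂μ) m).eval (X ω)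
            * ((n + 1 : ℝ[X]) * wickPolynomial (∫ ω, Y ω ^ 2 ∂μ) n).eval (Y ω)
          = (n + 1) * ((wickPolynomial (∫ ω, X ω ^ 2 ∂μ) m).eval (X ω)
            * (wickPolynomial (∫ ω, Y ω ^ 2 ∂μ) n).eval (Y ω)) := by
        simp only [eval_mul, eval_add, eval_natCast, eval_one]
        ring
      simp_rw [scalar]
      rw [integral_const_mul, ih]
      simp only [Nat.add_right_cancel_iff, Nat.factorial_succ]
      push_cast
      split_ifs
      · ring
      · rw [mul_zero, mul_zero]

lemma integral_wickPolynomial_succ (hX : HasGaussianLaw X μ) (hX0 : ∫ ω, X ω ∂μ = 0) (n : ℕ) :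
    ∫ ω, (wickPolynomial (∫ ω, X ω ^ 2 ∂μ) (n + 1)).eval (X ω) ∂μ = 0 := by
  have hXX : HasGaussianLaw (fun ω => (X ω, X ω)) μ := by
    simpa using hX.map_fun ((ContinuousLinearMap.id ℝ ℝ).prod (ContinuousLinearMap.id ℝ ℝ))
  simpa [wickPolynomial] using integral_wickPolynomial_mul_wickPolynomial hXX hX0 hX0 (n + 1) 0

end Wick

section LinearImage

variable {Ω ι κ ι' κ' : Type*} [MeasurableSpace Ω] {μ : Measure Ω} [Fintype ι] [Fintype ι']
  {X : Ω → ι → ℝ} {Y : Ω → ι' → ℝ}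

lemma integral_mulVec_eq_zero (hX : ∀ i, HasAllMoments (fun ω => X ω i) μ)
    (h0 : ∀ i, ∫ ω, X ω i ∂μ = 0) (B : Matrix κ ι ℝ) (k : κ) : ∫ ω, (B *ᵥ X ω) k ∂μ = 0 := by
  simp only [Matrix.mulVec, dotProduct]
  rw [integral_finsetSum _ fun i _ => ((hX i).const_mul (B k i)).integrable]
  simp only [integral_const_mul, h0, mul_zero, Finset.sum_const_zero]

lemma integral_mulVec_mul_mulVec (hX : ∀ i, HasAllMoments (fun ω => X ω i) μ)
    (hY : ∀ i, HasAllMoments (fun ω => Y ω i) μ) {K : Matrix ι ι' ℝ}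
    (hK : ∀ i j, ∫ ω, X ω i * Y ω j ∂μ = K i j) (B : Matrix κ ι ℝ) (B' : Matrix κ' ι' ℝ)
    (k : κ) (l : κ') : ∫ ω, (B *ᵥ X ω) k * (B' *ᵥ Y ω) l ∂μ = (B * K * B'ᵀ) k l := by
  have expand (ω : Ω) : (B *ᵥ X ω) k * (B' *ᵥ Y ω) l
      = ∑ i, ∑ j, B k i * B' l j * (X ω i * Y ω j) := by
    simp only [Matrix.mulVec, dotProduct, Finset.sum_mul_sum]
    exact Finset.sum_congr rfl fun i _ => Finset.sum_congr rfl fun j _ => by ring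
  have moments (i : ι) (j : ι') : HasAllMoments (fun ω => B k i * B' l j * (X ω i * Y ω j)) μ :=
    ((hX i).mul (hY j)).const_mul _
  simp_rw [expand]
  rw [integral_finsetSum _ fun i _ => (HasAllMoments.sum _ fun j _ => moments i j).integrable]
  simp_rw [integral_finsetSum _ fun j _ => (moments _ j).integrable, integral_const_mul, hK,
    Matrix.mul_apply, Matrix.transpose_apply, Finset.sum_mul]
  rw [Finset.sum_comm]
  exact Finset.sum_congr rfl fun i _ => Finset.sum_congr rfl fun j _ => by ring

end LinearImage

section GaussianVector

/-- `X` is a centred Gaussian vector with covariance matrix `K`. It lets the covariance matrix of a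
linear image of `X` be computed by matrix algebra. -/
structure IsCentredGaussianVector {Ω ι : Type*} [MeasurableSpace Ω] [Fintype ι] (X : Ω → ι → ℝ)
    (K : Matrix ι ι ℝ) (μ : Measure Ω) : Prop where
  hasGaussianLaw : HasGaussianLaw X μ
  integral_eq_zero : ∀ i, ∫ ω, X ω i ∂μ = 0
  integral_mul : ∀ i j, ∫ ω, X ω i * X ω j ∂μ = K i j

namespace IsCentredGaussianVector

variable {Ω ι κ : Type*} [MeasurableSpace Ω] {μ : Measure Ω} [Fintype ι] [Fintype κ]
  {X : Ω → ι → ℝ} {K : Matrix ι ι ℝ}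

lemma hasAllMoments (hX : IsCentredGaussianVector X K μ) (i : ι) :
    HasAllMoments (fun ω => X ω i) μ :=
  hasAllMoments_of_hasGaussianLaw (hX.hasGaussianLaw.eval i)

lemma isHermitian (hX : IsCentredGaussianVector X K μ) : K.IsHermitian := by
  ext i j
  simp only [Matrix.conjTranspose_apply, star_trivial, ← hX.integral_mul, mul_comm]

lemma mulVec (hX : IsCentredGaussianVector X K μ) (B : Matrix κ ι ℝ) :
    IsCentredGaussianVector (fun ω => B *ᵥ X ω) (B * K * Bᵀ) μ where
  hasGaussianLaw := hX.hasGaussianLaw.map_fun (LinearMap.toContinuousLinearMap B.mulVecLin)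
  integral_eq_zero := integral_mulVec_eq_zero hX.hasAllMoments hX.integral_eq_zero B
  integral_mul := integral_mulVec_mul_mulVec hX.hasAllMoments hX.hasAllMoments hX.integral_mul B B

lemma exists_diagonal [DecidableEq ι] (hX : IsCentredGaussianVector X K μ) :
    ∃ (Z : Ω → ι → ℝ) (v : ι → ℝ), IsCentredGaussianVector Z (Matrix.diagonal v) μ ∧
      (∀ ω, ∑ i, Z ω i ^ 2 = ∑ i, X ω i ^ 2) ∧ ∑ i, v i = K.trace ∧
      ∑ i, v i ^ 2 = ∑ i, ∑ j, K i j ^ 2 := by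
  have hK := hX.isHermitian
  set U : Matrix ι ι ℝ := hK.eigenvectorUnitary.1
  have hU : U * Uᵀ = 1 := Unitary.mul_star_self_of_mem hK.eigenvectorUnitary.2
  have hU' : Uᵀ * U = 1 := Unitary.star_mul_self_of_mem hK.eigenvectorUnitary.2
  have spectral : K = U * Matrix.diagonal hK.eigenvalues * Uᵀ := hK.spectral_theorem
  have diagonal : Uᵀ * K * U = Matrix.diagonal hK.eigenvalues := by
    calc Uᵀ * K * U = Uᵀ * (U * Matrix.diagonal hK.eigenvalues * Uᵀ) * U :=
          congrArg (fun M => Uᵀ * M * U) spectral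
      _ = (Uᵀ * U) * Matrix.diagonal hK.eigenvalues * (Uᵀ * U) := by simp only [Matrix.mul_assoc]
      _ = Matrix.diagonal hK.eigenvalues := by rw [hU', Matrix.one_mul, Matrix.mul_one]
  refine ⟨_, hK.eigenvalues,
    by simpa only [Matrix.transpose_transpose, diagonal] using hX.mulVec Uᵀ, fun ω => ?_,
    by simpa using hK.trace_eq_sum_eigenvalues.symm, ?_⟩
  · have isometry (x : ι → ℝ) : (Uᵀ *ᵥ x) ⬝ᵥ (Uᵀ *ᵥ x) = x ⬝ᵥ x := by
      rw [Matrix.dotProduct_mulVec, Matrix.vecMul_transpose, Matrix.mulVec_mulVec, hU,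
        Matrix.one_mulVec]
    simpa only [dotProduct, ← sq] using isometry (X ω)
  · have sq_trace := congrArg Matrix.trace <|
      calc Matrix.diagonal hK.eigenvalues * Matrix.diagonal hK.eigenvalues
          = Uᵀ * K * (U * Uᵀ) * K * U := by rw [← diagonal]; simp only [Matrix.mul_assoc]
        _ = Uᵀ * (K * K) * U := by rw [hU, Matrix.mul_one, Matrix.mul_assoc Uᵀ]
    rw [Matrix.trace_mul_cycle, hU, Matrix.one_mul] at sq_trace
    rw [Matrix.diagonal_mul_diagonal, Matrix.trace_diagonal] at sq_trace
    simp only [sq, sq_trace, Matrix.trace, Matrix.diag, Matrix.mul_apply]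
    refine Finset.sum_congr rfl fun i _ => Finset.sum_congr rfl fun j _ => ?_
    rw [← hK.apply i j, star_trivial]

end IsCentredGaussianVector

end GaussianVector

section QuadraticForm

lemma inv_sqrt_one_sub_le_exp {y : ℝ} (hy : y ≤ 1 / 2) :
    (√(1 - y))⁻¹ ≤ Real.exp (y / 2 + y ^ 2) := by
  have pos : 0 < 1 - y := by linarith
  have inv_le : (1 - y)⁻¹ ≤ Real.exp (y + 2 * y ^ 2) :=
    calc (1 - y)⁻¹ = y / (1 - y) + 1 := by field_simp; ring
      _ ≤ (y + 2 * y ^ 2) + 1 := by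
        gcongr
        rw [div_le_iff₀ pos]
        nlinarith [mul_nonneg (sq_nonneg y) (by linarith : 0 ≤ 1 - 2 * y)]
      _ ≤ _ := Real.add_one_le_exp _
  rw [← Real.sqrt_inv]
  refine Real.sqrt_le_iff.2 ⟨(Real.exp_pos _).le, inv_le.trans_eq ?_⟩
  rw [← Real.exp_nat_mul]
  push_cast
  ring_nf

lemma integral_exp_sq_sub_gaussianReal {v : NNReal} {t : ℝ} (h : t * v ≤ 1 / 4) :
    ∫ x, Real.exp (t * (x ^ 2 - v)) ∂gaussianReal 0 v
      = Real.exp (-(t * v)) * (√(1 - 2 * (t * v)))⁻¹ := by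
  rcases eq_or_ne v 0 with rfl | hv
  · simp
  have : (0 : ℝ) < v := by positivity
  have gaussian (x : ℝ) : gaussianPDFReal 0 v x • Real.exp (t * (x ^ 2 - v))
      = ((√(2 * Real.pi * v))⁻¹ * Real.exp (-(t * v))) *
        Real.exp (-(1 / (2 * v) - t) * x ^ 2) := by
    rw [gaussianPDFReal, smul_eq_mul, mul_assoc (√_)⁻¹, mul_assoc (√_)⁻¹, ← Real.exp_add,
      ← Real.exp_add]
    congr 2
    field_simp
    ring
  have precision : 1 / (2 * (v : ℝ)) - t = (1 - 2 * (t * v)) / (2 * v) := by field_simp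
  have : 1 - 2 * (t * v) ≠ 0 := by linarith
  simp_rw [integral_gaussianReal_eq_integral_smul hv, gaussian]
  rw [integral_const_mul, integral_gaussian, mul_comm (√(2 * Real.pi * v))⁻¹, mul_assoc,
    ← Real.sqrt_inv, ← Real.sqrt_inv, ← Real.sqrt_mul (by positivity), precision]
  congr 2
  field_simp

variable {Ω : Type*} [MeasurableSpace Ω] {μ : Measure Ω}

lemma mgf_sq_sub_eq {X : Ω → ℝ} (hX : HasGaussianLaw X μ) (h0 : ∫ ω, X ω ∂μ = 0) {s t : ℝ}
    (hs : ∫ ω, X ω ^ 2 ∂μ = s) (h : t * s ≤ 1 / 4) :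
    mgf (fun ω => X ω ^ 2 - s) μ t = Real.exp (-(t * s)) * (√(1 - 2 * (t * s)))⁻¹ := by
  have hs0 : 0 ≤ s := hs ▸ integral_nonneg fun ω => sq_nonneg _
  lift s to NNReal using hs0
  have law := map_eq_gaussianReal_of_integral_eq_zero hX h0
  rw [hs, Real.toNNReal_coe] at law
  rw [← integral_exp_sq_sub_gaussianReal h, ← law, integral_map hX.aemeasurable (by fun_prop), mgf]

lemma mgf_sq_sub_pos_and_le {X : Ω → ℝ} (hX : HasGaussianLaw X μ) (h0 : ∫ ω, X ω ∂μ = 0) {s t : ℝ}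
    (hs : ∫ ω, X ω ^ 2 ∂μ = s) (h : t * s ≤ 1 / 4) :
    0 < mgf (fun ω => X ω ^ 2 - s) μ t ∧
      mgf (fun ω => X ω ^ 2 - s) μ t ≤ Real.exp (4 * t ^ 2 * s ^ 2) := by
  have pos : 0 < 1 - 2 * (t * s) := by linarith
  rw [mgf_sq_sub_eq hX h0 hs h]
  refine ⟨by positivity, ?_⟩
  calc Real.exp (-(t * s)) * (√(1 - 2 * (t * s)))⁻¹
      ≤ Real.exp (-(t * s)) * Real.exp ((2 * (t * s)) / 2 + (2 * (t * s)) ^ 2) := by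
        gcongr
        exact inv_sqrt_one_sub_le_exp (by linarith)
    _ = Real.exp (4 * t ^ 2 * s ^ 2) := by rw [← Real.exp_add]; ring_nf

namespace IsCentredGaussianVector

variable {ι : Type*} [Fintype ι] {X : Ω → ι → ℝ} {K : Matrix ι ι ℝ}

lemma integrable_exp_of_diagonal [DecidableEq ι] {v : ι → ℝ}
    (hX : IsCentredGaussianVector X (Matrix.diagonal v) μ) {t : ℝ}
    (ht : 16 * t ^ 2 * ∑ i, v i ^ 2 ≤ 1) :
    Integrable (fun ω => Real.exp (t * ∑ i, (X ω i ^ 2 - v i))) μ ∧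
      ∫ ω, Real.exp (t * ∑ i, (X ω i ^ 2 - v i)) ∂μ ≤ Real.exp (4 * t ^ 2 * ∑ i, v i ^ 2) := by
  have : IsProbabilityMeasure μ := hX.hasGaussianLaw.isProbabilityMeasure
  have small (i : ι) : t * v i ≤ 1 / 4 := by
    have h : v i ^ 2 ≤ ∑ i, v i ^ 2 :=
      Finset.single_le_sum (f := fun i => v i ^ 2) (fun _ _ => sq_nonneg _) (Finset.mem_univ i)
    refine (abs_le_of_sq_le_sq' ?_ (by norm_num)).2
    nlinarith [mul_le_mul_of_nonneg_left h (sq_nonneg t)]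
  have factor (i : ι) := mgf_sq_sub_pos_and_le (hX.hasGaussianLaw.eval i) (hX.integral_eq_zero i)
    (by simpa [sq] using hX.integral_mul i i) (small i)
  have indep : iIndepFun (fun i ω => X ω i ^ 2 - v i) μ := by
    refine (hX.hasGaussianLaw.iIndepFun_of_covariance_eq_zero fun i j hij => ?_).comp
      (fun i x => x ^ 2 - v i) fun i => by fun_prop
    rw [covariance_eq_sub (hX.hasAllMoments i).memLp_two (hX.hasAllMoments j).memLp_two]
    simp [hX.integral_eq_zero, hX.integral_mul, hij]
  have mgf_eq : mgf (fun ω => ∑ i, (X ω i ^ 2 - v i)) μ t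
      = ∏ i, mgf (fun ω => X ω i ^ 2 - v i) μ t := by
    rw [← indep.mgf_sum₀ fun i =>
      ((hX.hasAllMoments i).pow 2).integrable.aemeasurable.sub_const _]
    congr 1
    ext ω
    rw [Finset.sum_apply]
  constructor
  · exact mgf_pos_iff.1 (mgf_eq ▸ Finset.prod_pos fun i _ => (factor i).1)
  · change mgf (fun ω => ∑ i, (X ω i ^ 2 - v i)) μ t ≤ _
    rw [mgf_eq, Finset.mul_sum, Real.exp_sum]
    exact Finset.prod_le_prod (fun i _ => (factor i).1.le) fun i _ => (factor i).2

lemma integrable_exp_sum_sq_sub (hX : IsCentredGaussianVector X K μ) {t : ℝ}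
    (ht : 16 * t ^ 2 * ∑ i, ∑ j, K i j ^ 2 ≤ 1) :
    Integrable (fun ω => Real.exp (t * ∑ i, (X ω i ^ 2 - K i i))) μ ∧
      ∫ ω, Real.exp (t * ∑ i, (X ω i ^ 2 - K i i)) ∂μ
        ≤ Real.exp (4 * t ^ 2 * ∑ i, ∑ j, K i j ^ 2) := by
  classical
  obtain ⟨Z, v, hZ, sum_sq, trace, frobenius⟩ := hX.exists_diagonal
  have h (ω : Ω) : ∑ i, (X ω i ^ 2 - K i i) = ∑ i, (Z ω i ^ 2 - v i) := by
    rw [Finset.sum_sub_distrib, Finset.sum_sub_distrib, sum_sq, trace]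
    rfl
  simp_rw [h]
  rw [← frobenius] at ht ⊢
  exact hZ.integrable_exp_of_diagonal ht

lemma pow_even_le_factorial_mul_exp_add_exp_neg (x : ℝ) (m : ℕ) :
    x ^ (2 * m) ≤ (2 * m).factorial * (Real.exp x + Real.exp (-x)) := by
  have taylor := Real.pow_div_factorial_le_exp |x| (abs_nonneg x) (2 * m)
  rw [(even_two_mul m).pow_abs, div_le_iff₀' (by positivity)] at taylor
  exact taylor.trans (by gcongr; exact Real.exp_abs_le x)

lemma integral_sum_sq_sub_pow_le (hX : IsCentredGaussianVector X K μ) {V : ℝ} (hV : 0 < V)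
    (hKV : ∑ i, ∑ j, K i j ^ 2 ≤ V) (m : ℕ) :
    ∫ ω, (∑ i, (X ω i ^ 2 - K i i)) ^ (2 * m) ∂μ
      ≤ (2 * m).factorial * 16 ^ m * (2 * Real.exp 1) * V ^ m := by
  set S : Ω → ℝ := fun ω => ∑ i, (X ω i ^ 2 - K i i)
  set t : ℝ := (4 * √V)⁻¹ with ht
  have htV : 16 * t ^ 2 * V = 1 := by
    rw [ht, inv_pow, mul_pow, Real.sq_sqrt hV.le]
    field_simp
    norm_num
  have admissible : 16 * t ^ 2 * ∑ i, ∑ j, K i j ^ 2 ≤ 1 := by rw [← htV]; gcongr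
  have bound : Real.exp (4 * t ^ 2 * ∑ i, ∑ j, K i j ^ 2) ≤ Real.exp 1 := by
    gcongr
    nlinarith
  obtain ⟨int_pos, exp_pos⟩ := hX.integrable_exp_sum_sq_sub admissible
  obtain ⟨int_neg, exp_neg⟩ := hX.integrable_exp_sum_sq_sub (t := -t) (by rwa [neg_sq])
  rw [neg_sq] at exp_neg
  have pow_le (ω : Ω) : S ω ^ (2 * m) ≤ ((2 * m).factorial * 16 ^ m * V ^ m) *
      (Real.exp (t * S ω) + Real.exp (-t * S ω)) := by
    calc S ω ^ (2 * m) = (16 * t ^ 2 * V) ^ m * S ω ^ (2 * m) := by rw [htV, one_pow, one_mul]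
      _ = (16 * V) ^ m * (t * S ω) ^ (2 * m) := by
        rw [mul_pow t, pow_mul t]
        simp only [mul_pow]
        ring
      _ ≤ (16 * V) ^ m * ((2 * m).factorial * (Real.exp (t * S ω) + Real.exp (-t * S ω))) := by
        gcongr
        simpa only [neg_mul] using pow_even_le_factorial_mul_exp_add_exp_neg (t * S ω) m
      _ = _ := by rw [mul_pow]; ring
  calc ∫ ω, S ω ^ (2 * m) ∂μ
      ≤ ∫ ω, ((2 * m).factorial * 16 ^ m * V ^ m) *
        (Real.exp (t * S ω) + Real.exp (-t * S ω)) ∂μ :=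
        integral_mono_of_nonneg (ae_of_all _ fun ω => (even_two_mul m).pow_nonneg _)
          ((int_pos.add int_neg).const_mul _) (ae_of_all _ pow_le)
    _ ≤ ((2 * m).factorial * 16 ^ m * V ^ m) * (2 * Real.exp 1) := by
        rw [integral_const_mul, integral_add int_pos int_neg]
        gcongr
        linarith [exp_pos.trans bound, exp_neg.trans bound]
    _ = _ := by ring

end IsCentredGaussianVector

end QuadraticForm

section TimeAverages

/-- The time average `(1/N) ∑_{n=1}^N f(n)`, equal to `0` at `N = 0`. -/
noncomputable def timeAverage (f : ℤ → ℝ) (N : ℕ) : ℝ :=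
  1 / (N : ℝ) * ∑ n ∈ Finset.Icc 1 N, f n

/-- The average of a function of the lag, `(1/N²) ∑_{s,t=1}^N f(s - t)`: the mean of a product
of two time averages of jointly stationary processes with lagged cross moments `f`. -/
noncomputable def lagAverage (f : ℤ → ℝ) (N : ℕ) : ℝ :=
  1 / (N : ℝ) ^ 2 * ∑ s ∈ Finset.Icc 1 N, ∑ t ∈ Finset.Icc 1 N, f ((s : ℤ) - t)

lemma timeAverage_pow_le_of_even (f : ℤ → ℝ) (N : ℕ) {m : ℕ} (hm : Even m) (hm0 : m ≠ 0) :
    timeAverage f N ^ m ≤ timeAverage (fun n => f n ^ m) N := by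
  rcases Nat.eq_zero_or_pos N with rfl | hN
  · simp [timeAverage, hm0]
  have weights : ∑ _n ∈ Finset.Icc 1 N, 1 / (N : ℝ) = 1 := by
    simp only [Finset.sum_const, Nat.card_Icc, Nat.add_sub_cancel, nsmul_eq_mul]
    field_simp
  simpa only [timeAverage, Finset.mul_sum] using Real.pow_arith_mean_le_arith_mean_pow_of_even
    (Finset.Icc 1 N) (fun _ => 1 / (N : ℝ)) (fun n => f n) (fun _ _ => by positivity) weights hm

lemma lagAverage_const_mul (c : ℝ) (f : ℤ → ℝ) (N : ℕ) :
    lagAverage (fun τ => c * f τ) N = c * lagAverage f N := by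
  simp only [lagAverage, ← Finset.mul_sum, mul_left_comm]

lemma lagAverage_sum {ι : Type*} (s : Finset ι) (f : ι → ℤ → ℝ) (N : ℕ) :
    lagAverage (fun τ => ∑ i ∈ s, f i τ) N = ∑ i ∈ s, lagAverage (f i) N := by
  simp only [lagAverage, ← Finset.mul_sum]
  congr 1
  symm
  rw [Finset.sum_comm]
  exact Finset.sum_congr rfl fun _ _ => Finset.sum_comm

lemma sum_Icc_natCast_sub (g : ℤ → ℝ) (N : ℕ) :
    ∑ t ∈ Finset.Icc 1 N, g (((N + 1 : ℕ) : ℤ) - t) = ∑ t ∈ Finset.Icc 1 N, g t := by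
  refine Finset.sum_nbij' (fun t => N + 1 - t) (fun t => N + 1 - t) ?_ ?_ ?_ ?_ ?_ <;>
    simp only [Finset.mem_Icc] <;> intro t ht
  · lia
  · lia
  · lia
  · lia
  · congr 1
    lia

lemma sum_sum_sub_eq (f : ℤ → ℝ) (N : ℕ) :
    ∑ s ∈ Finset.Icc 1 N, ∑ t ∈ Finset.Icc 1 N, f ((s : ℤ) - t)
      = N * f 0 + ∑ τ ∈ Finset.Icc 1 N, ((N : ℝ) - τ) * (f τ + f (-τ)) := by
  induction N with
  | zero => simp
  | succ N ih =>
    have backward : ∑ t ∈ Finset.Icc 1 N, f ((t : ℤ) - (N + 1 : ℕ))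
        = ∑ t ∈ Finset.Icc 1 N, f (-(t : ℤ)) := by
      simpa only [neg_sub] using sum_Icc_natCast_sub (fun t => f (-t)) N
    have weights : ∑ τ ∈ Finset.Icc 1 N, (((N + 1 : ℕ) : ℝ) - τ) * (f τ + f (-τ))
        = ∑ τ ∈ Finset.Icc 1 N, ((N : ℝ) - τ) * (f τ + f (-τ))
          + (∑ τ ∈ Finset.Icc 1 N, f τ + ∑ τ ∈ Finset.Icc 1 N, f (-τ)) := by
      rw [← Finset.sum_add_distrib, ← Finset.sum_add_distrib]
      refine Finset.sum_congr rfl fun τ _ => ?_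
      push_cast
      ring
    simp only [Finset.sum_Icc_succ_top (Nat.le_add_left 1 N), Finset.sum_add_distrib]
    rw [ih, backward, sum_Icc_natCast_sub, weights, sub_self]
    push_cast
    ring

lemma lagAverage_eq (f : ℤ → ℝ) (N : ℕ) :
    lagAverage f N = f 0 / N
      + 1 / (N : ℝ) ^ 2 * ∑ τ ∈ Finset.Icc 1 (N - 1), ((N : ℝ) - τ) * (f τ + f (-τ)) := by
  rcases N with _ | N
  · simp [lagAverage]
  rw [lagAverage, sum_sum_sub_eq, Finset.sum_Icc_succ_top (Nat.le_add_left 1 N), sub_self, zero_mul,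
    add_zero, Nat.add_sub_cancel]
  field_simp

lemma sum_sum_sub_le {f : ℤ → ℝ} (hf : Summable f) (h0 : ∀ τ, 0 ≤ f τ) (N : ℕ) :
    ∑ s ∈ Finset.Icc 1 N, ∑ t ∈ Finset.Icc 1 N, f ((s : ℤ) - t) ≤ N * ∑' τ, f τ := by
  have row (s : ℕ) : ∑ t ∈ Finset.Icc 1 N, f ((s : ℤ) - t) ≤ ∑' τ, f τ := by
    have inj : Function.Injective fun t : ℕ => (s : ℤ) - t := fun a b h => by simpa using h
    exact ((hf.comp_injective inj).sum_le_tsum _ fun t _ => h0 _).trans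
      (tsum_comp_le_tsum_of_inj hf h0 inj)
  exact (Finset.sum_le_sum fun s _ => row s).trans (by simp)

lemma isBigO_lagAverage {f : ℤ → ℝ} (hf : Summable f) :
    lagAverage f =O[atTop] fun N : ℕ => 1 / (N : ℝ) := by
  refine IsBigO.of_bound (∑' τ, |f τ|) (Eventually.of_forall fun N => ?_)
  calc |lagAverage f N|
      ≤ 1 / (N : ℝ) ^ 2 * ∑ s ∈ Finset.Icc 1 N, ∑ t ∈ Finset.Icc 1 N, |f ((s : ℤ) - t)| := by
        rw [lagAverage, abs_mul, abs_of_nonneg (by positivity : 0 ≤ 1 / (N : ℝ) ^ 2)]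
        gcongr
        exact (Finset.abs_sum_le_sum_abs _ _).trans
          (Finset.sum_le_sum fun s _ => Finset.abs_sum_le_sum_abs _ _)
    _ ≤ 1 / (N : ℝ) ^ 2 * (N * ∑' τ, |f τ|) := by
        gcongr
        exact sum_sum_sub_le (f := fun τ => |f τ|) hf.abs (fun τ => abs_nonneg _) N
    _ = (∑' τ, |f τ|) * |1 / (N : ℝ)| := by
        rw [abs_of_nonneg (by positivity : 0 ≤ 1 / (N : ℝ))]
        field_simp

lemma summable_pow_of_summable_sq {ι : Type*} {f : ι → ℝ} (hf : Summable fun i => f i ^ 2) {m : ℕ}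
    (hm : 2 ≤ m) : Summable fun i => f i ^ m := by
  refine hf.of_norm_bounded_eventually ?_
  filter_upwards [hf.tendsto_cofinite_zero.eventually_le_const zero_lt_one] with i hi
  rw [norm_pow, Real.norm_eq_abs, ← sq_abs (f i)]
  exact pow_le_pow_of_le_one (abs_nonneg _) (sq_le_one_iff_abs_le_one _ |>.1 hi) hm

variable {Ω : Type*} [MeasurableSpace Ω] {μ : Measure Ω} {f g : ℤ → Ω → ℝ}

lemma HasAllMoments.timeAverage (hf : ∀ n, HasAllMoments (f n) μ) (N : ℕ) :
    HasAllMoments (fun ω => timeAverage (fun n => f n ω) N) μ :=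
  (HasAllMoments.sum (f := fun (n : ℕ) ω => f n ω) _ fun n _ => hf n).const_mul _

lemma integral_timeAverage (hf : ∀ n, HasAllMoments (f n) μ) (N : ℕ) :
    ∫ ω, timeAverage (fun n => f n ω) N ∂μ = timeAverage (fun n => ∫ ω, f n ω ∂μ) N := by
  simp only [timeAverage]
  rw [integral_const_mul, integral_finsetSum _ fun (n : ℕ) _ => (hf n).integrable]

lemma integral_timeAverage_mul_timeAverage (hf : ∀ n, HasAllMoments (f n) μ)
    (hg : ∀ n, HasAllMoments (g n) μ) {c : ℤ → ℝ}
    (hc : ∀ s t, ∫ ω, f s ω * g t ω ∂μ = c (s - t)) (N : ℕ) :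
    ∫ ω, timeAverage (fun n => f n ω) N * timeAverage (fun n => g n ω) N ∂μ = lagAverage c N := by
  have expand (ω : Ω) : timeAverage (fun n => f n ω) N * timeAverage (fun n => g n ω) N
      = 1 / (N : ℝ) ^ 2 * ∑ s ∈ Finset.Icc 1 N, ∑ t ∈ Finset.Icc 1 N, f s ω * g t ω := by
    rw [_root_.timeAverage, _root_.timeAverage, ← Finset.sum_mul_sum]
    ring
  simp_rw [expand]
  rw [integral_const_mul, lagAverage, integral_finsetSum _ fun (s : ℕ) _ => (HasAllMoments.sum _
    fun (t : ℕ) _ => (hf s).mul (hg t)).integrable]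
  simp_rw [integral_finsetSum _ fun (t : ℕ) _ => ((hf _).mul (hg t)).integrable, hc]

end TimeAverages

section StationaryProcess

/-- `x` is a centred, wide-sense stationary, jointly Gaussian process with values in `ℝ^κ`, and `S`
is its matrix of lagged covariances. -/
structure IsStationaryGaussianProcess {Ω κ : Type*} [MeasurableSpace Ω] (x : ℤ → Ω → κ → ℝ)
    (S : ℤ → Matrix κ κ ℝ) (μ : Measure Ω) : Prop where
  isGaussianProcess : IsGaussianProcess (fun (p : ℤ × κ) ω => x p.1 ω p.2) μ
  integral_eq_zero : ∀ n k, ∫ ω, x n ω k ∂μ = 0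
  integral_mul : ∀ s t k l, ∫ ω, x s ω k * x t ω l ∂μ = S (s - t) k l

/-- The time averages of the `m`-th Wick powers of the coordinates of a process, the coordinate `k`
having variance `s k`. -/
noncomputable def wickAverage {Ω κ : Type*} (x : ℤ → Ω → κ → ℝ) (s : κ → ℝ) (m N : ℕ) (ω : Ω) :
    κ → ℝ :=
  fun k => timeAverage (fun n => (wickPolynomial (s k) m).eval (x n ω k)) N

namespace IsStationaryGaussianProcess

variable {Ω κ κ' : Type*} [MeasurableSpace Ω] {μ : Measure Ω} {x : ℤ → Ω → κ → ℝ}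
  {S : ℤ → Matrix κ κ ℝ}

lemma hasGaussianLaw (hx : IsStationaryGaussianProcess x S μ) (n : ℤ) (k : κ) :
    HasGaussianLaw (fun ω => x n ω k) μ := hx.isGaussianProcess.hasGaussianLaw_eval (n, k)

lemma hasAllMoments (hx : IsStationaryGaussianProcess x S μ) (n : ℤ) (k : κ) :
    HasAllMoments (fun ω => x n ω k) μ := hasAllMoments_of_hasGaussianLaw (hx.hasGaussianLaw n k)

lemma integral_sq (hx : IsStationaryGaussianProcess x S μ) (n : ℤ) (k : κ) :
    ∫ ω, x n ω k ^ 2 ∂μ = S 0 k k := by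
  simp_rw [sq, hx.integral_mul, sub_self]

lemma mulVec [Fintype κ] (hx : IsStationaryGaussianProcess x S μ) (B : Matrix κ' κ ℝ) :
    IsStationaryGaussianProcess (fun n ω => B *ᵥ x n ω) (fun τ => B * S τ * Bᵀ) μ where
  isGaussianProcess := by
    classical
    refine hx.isGaussianProcess.of_isGaussianProcess fun p =>
      ⟨Finset.univ.image fun k => (p.1, k), ∑ k, B p.2 k • ContinuousLinearMap.proj
        (R := ℝ) ⟨(p.1, k), Finset.mem_image_of_mem _ (Finset.mem_univ k)⟩, fun ω => ?_⟩
    simp [Matrix.mulVec, dotProduct]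
  integral_eq_zero n := integral_mulVec_eq_zero (hx.hasAllMoments n) (hx.integral_eq_zero n) B
  integral_mul s t := integral_mulVec_mul_mulVec (hx.hasAllMoments s) (hx.hasAllMoments t)
    (hx.integral_mul s t) B B

lemma isCentredGaussianVector (hx : IsStationaryGaussianProcess x S μ) (k : κ) (I : Finset ℕ) :
    IsCentredGaussianVector (fun ω (n : I) => x (n : ℕ) ω k)
      (Matrix.of fun s t : I => S ((s : ℕ) - (t : ℕ) : ℤ) k k) μ where
  hasGaussianLaw :=
    (hx.isGaussianProcess.comp_right fun n : ℕ => ((n : ℤ), k)).hasGaussianLaw I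
  integral_eq_zero n := hx.integral_eq_zero n k
  integral_mul s t := hx.integral_mul s t k k

lemma hasAllMoments_wickPolynomial (hx : IsStationaryGaussianProcess x S μ) (s : ℝ) (m : ℕ) (k : κ)
    (n : ℤ) : HasAllMoments (fun ω => (wickPolynomial s m).eval (x n ω k)) μ :=
  have : IsProbabilityMeasure μ := hx.isGaussianProcess.isProbabilityMeasure
  (hx.hasAllMoments n k).polynomial_eval _

lemma hasAllMoments_wickAverage (hx : IsStationaryGaussianProcess x S μ) (s : κ → ℝ) (m N : ℕ)
    (k : κ) : HasAllMoments (fun ω => wickAverage x s m N ω k) μ :=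
  HasAllMoments.timeAverage (hx.hasAllMoments_wickPolynomial (s k) m k) N

lemma integral_wickAverage_succ (hx : IsStationaryGaussianProcess x S μ) (m N : ℕ) (k : κ) :
    ∫ ω, wickAverage x (S 0).diag (m + 1) N ω k ∂μ = 0 := by
  have wick (n : ℤ) := integral_wickPolynomial_succ (hx.hasGaussianLaw n k)
    (hx.integral_eq_zero n k) m
  simp_rw [hx.integral_sq] at wick
  simp only [wickAverage, Matrix.diag]
  rw [integral_timeAverage (hx.hasAllMoments_wickPolynomial _ _ k)]
  simp [timeAverage, wick]

lemma integral_wickAverage_mul_wickAverage (hx : IsStationaryGaussianProcess x S μ) (m n N : ℕ)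
    (k l : κ) :
    ∫ ω, wickAverage x (S 0).diag m N ω k * wickAverage x (S 0).diag n N ω l ∂μ
      = lagAverage (fun τ => if m = n then n.factorial * S τ k l ^ n else 0) N := by
  refine integral_timeAverage_mul_timeAverage (hx.hasAllMoments_wickPolynomial _ m k)
    (hx.hasAllMoments_wickPolynomial _ n l) (c := fun τ => ite _ _ _) (fun s t => ?_) N
  have wick := integral_wickPolynomial_mul_wickPolynomial
    (hx.isGaussianProcess.hasGaussianLaw_prodMk (s := (s, k)) (t := (t, l)))
    (hx.integral_eq_zero s k) (hx.integral_eq_zero t l) m n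
  simpa only [hx.integral_sq, hx.integral_mul, Matrix.diag] using wick

lemma isBigO_integral_wickAverage_two_pow (hx : IsStationaryGaussianProcess x S μ) {k : κ}
    (hS : Summable fun τ => S τ k k ^ 2) (m : ℕ) :
    (fun N => ∫ ω, wickAverage x (S 0).diag 2 N ω k ^ (2 * m) ∂μ)
      =O[atTop] fun N : ℕ => (1 / (N : ℝ)) ^ m := by
  set T : ℝ := ∑' τ, S τ k k ^ 2
  have hT : 0 ≤ T := tsum_nonneg fun τ => sq_nonneg _
  refine IsBigO.of_bound ((2 * m).factorial * 16 ^ m * (2 * Real.exp 1) * (T + 1) ^ m) ?_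
  filter_upwards [eventually_gt_atTop 0] with N hN
  have : (0 : ℝ) < N := by exact_mod_cast hN
  have frobenius : ∑ s : Finset.Icc 1 N, ∑ t : Finset.Icc 1 N,
      S ((s : ℕ) - (t : ℕ) : ℤ) k k ^ 2 ≤ N * (T + 1) := by
    have h := sum_sum_sub_le hS (fun τ => sq_nonneg _) N
    simp_rw [← Finset.sum_coe_sort (Finset.Icc 1 N)] at h
    exact h.trans (by gcongr; linarith)
  have moment := (hx.isCentredGaussianVector k (Finset.Icc 1 N)).integral_sum_sq_sub_pow_le
    (V := N * (T + 1)) (by positivity) frobenius m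
  have rescale (ω : Ω) : wickAverage x (S 0).diag 2 N ω k ^ (2 * m) = (1 / (N : ℝ)) ^ (2 * m) *
      (∑ n : Finset.Icc 1 N, (x (n : ℕ) ω k ^ 2 - S ((n : ℕ) - (n : ℕ) : ℤ) k k)) ^ (2 * m) := by
    simp only [wickAverage, timeAverage, eval_wickPolynomial_two, Matrix.diag, mul_pow, sub_self]
    rw [Finset.sum_coe_sort (Finset.Icc 1 N) fun n : ℕ => x n ω k ^ 2 - S 0 k k]
  rw [Real.norm_of_nonneg (integral_nonneg fun ω => (even_two_mul m).pow_nonneg _),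
    Real.norm_of_nonneg (by positivity)]
  simp_rw [rescale]
  rw [integral_const_mul]
  calc _ ≤ (1 / (N : ℝ)) ^ (2 * m) *
        ((2 * m).factorial * 16 ^ m * (2 * Real.exp 1) * (N * (T + 1)) ^ m) := by
        gcongr
        exact moment
    _ = _ := by
      rw [mul_pow (N : ℝ), two_mul m, pow_add, one_div_pow]
      field_simp

lemma isBigO_integral_wickAverage_sq (hx : IsStationaryGaussianProcess x S μ) {k : κ}
    (hS : Summable fun τ => S τ k k ^ 2) {m : ℕ} (hm : 2 ≤ m) :
    (fun N => ∫ ω, wickAverage x (S 0).diag m N ω k ^ 2 ∂μ)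
      =O[atTop] fun N : ℕ => 1 / (N : ℝ) := by
  simp_rw [sq, hx.integral_wickAverage_mul_wickAverage, if_true]
  exact isBigO_lagAverage ((summable_pow_of_summable_sq hS hm).mul_left _)

lemma integral_eval_eq (hx : IsStationaryGaussianProcess x S μ) (k : κ) (n : ℤ) (q : ℝ[X]) :
    ∫ ω, q.eval (x n ω k) ∂μ = ∫ ω, q.eval (x 0 ω k) ∂μ := by
  have law (n : ℤ) : μ.map (fun ω => x n ω k) = gaussianReal 0 (S 0 k k).toNNReal := by
    rw [map_eq_gaussianReal_of_integral_eq_zero (hx.hasGaussianLaw n k) (hx.integral_eq_zero n k),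
      hx.integral_sq]
  have map_integral (n : ℤ) : ∫ ω, q.eval (x n ω k) ∂μ
      = ∫ z, q.eval z ∂μ.map fun ω => x n ω k :=
    (integral_map (hx.hasGaussianLaw n k).aemeasurable q.continuous.aestronglyMeasurable).symm
  rw [map_integral, map_integral, law, law]

lemma isBigO_integral_wickAverage_pow (hx : IsStationaryGaussianProcess x S μ) (k : κ) (m : ℕ)
    {p : ℕ} (hp : Even p) :
    (fun N => ∫ ω, wickAverage x (S 0).diag m N ω k ^ p ∂μ)
      =O[atTop] fun _ : ℕ => (1 : ℝ) := by
  have : IsProbabilityMeasure μ := hx.isGaussianProcess.isProbabilityMeasure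
  rcases eq_or_ne p 0 with rfl | hp0
  · simpa using isBigO_refl (fun _ : ℕ => (1 : ℝ)) atTop
  set q := wickPolynomial (S 0 k k) m
  have moments (n : ℤ) : HasAllMoments (fun ω => q.eval (x n ω k) ^ p) μ :=
    (hx.hasAllMoments_wickPolynomial _ m k n).pow p
  refine IsBigO.of_bound (∫ ω, (q ^ p).eval (x 0 ω k) ∂μ) ?_
  filter_upwards [eventually_gt_atTop 0] with N hN
  rw [Real.norm_of_nonneg (integral_nonneg fun ω => hp.pow_nonneg _), norm_one, mul_one]
  calc ∫ ω, wickAverage x (S 0).diag m N ω k ^ p ∂μ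
      ≤ ∫ ω, timeAverage (fun n => q.eval (x n ω k) ^ p) N ∂μ :=
        integral_mono ((hx.hasAllMoments_wickAverage _ m N k).pow p).integrable
          (HasAllMoments.timeAverage moments N).integrable
          fun ω => timeAverage_pow_le_of_even _ N hp hp0
    _ = ∫ ω, (q ^ p).eval (x 0 ω k) ∂μ := by
        simp_rw [integral_timeAverage moments, ← eval_pow, hx.integral_eval_eq]
        simp only [timeAverage, Finset.sum_const, Nat.card_Icc, Nat.add_sub_cancel, nsmul_eq_mul]
        field_simp

end IsStationaryGaussianProcess

end StationaryProcess

section MatrixInverse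

variable {Ω n : Type*} [MeasurableSpace Ω] {μ : Measure Ω} [Fintype n] [DecidableEq n]
  {M : Ω → Matrix n n ℝ}

lemma aemeasurable_det (hM : ∀ i j, AEMeasurable (fun ω => M ω i j) μ) :
    AEMeasurable (fun ω => (M ω).det) μ := by
  simp only [Matrix.det_apply']
  fun_prop

lemma aemeasurable_inv_apply (hM : ∀ i j, AEMeasurable (fun ω => M ω i j) μ) (i j : n) :
    AEMeasurable (fun ω => (M ω)⁻¹ i j) μ := by
  simp only [Matrix.inv_def, Ring.inverse_eq_inv', Matrix.smul_apply, Matrix.adjugate_apply,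
    smul_eq_mul]
  refine (aemeasurable_det hM).inv.mul (aemeasurable_det fun k l => ?_)
  simp only [Matrix.updateRow_apply]
  split_ifs
  · exact aemeasurable_const
  · exact hM k l

end MatrixInverse

section MardiaKurtosis

variable {Ω : Type*} {p : ℕ} (x : ℤ → Ω → Fin p → ℝ) (N : ℕ) (ω : Ω)

lemma sampleCov_mulVec (A : Matrix (Fin p) (Fin p) ℝ) :
    sampleCov (fun n ω => A *ᵥ x n ω) N ω = A * sampleCov x N ω * Aᵀ := by
  simp only [sampleCov, Matrix.mul_smul, Matrix.smul_mul, Matrix.mul_sum, Matrix.sum_mul,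
    Matrix.mul_vecMulVec, Matrix.vecMulVec_mul, Matrix.vecMul_transpose]

lemma mardiaKurtosis_mulVec {A : Matrix (Fin p) (Fin p) ℝ} (hA : IsUnit A.det) :
    mardiaKurtosis (fun n ω => A *ᵥ x n ω) = mardiaKurtosis x := by
  ext N ω
  have form (v : Fin p → ℝ) : (A *ᵥ v) ⬝ᵥ ((A * sampleCov x N ω * Aᵀ)⁻¹ *ᵥ (A *ᵥ v))
      = v ⬝ᵥ ((sampleCov x N ω)⁻¹ *ᵥ v) := by
    rw [Matrix.mul_inv_rev, Matrix.mul_inv_rev, Matrix.mulVec_mulVec, Matrix.mul_assoc,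
      Matrix.mul_assoc, Matrix.nonsing_inv_mul A hA, Matrix.mul_one, Matrix.dotProduct_mulVec,
      ← Matrix.vecMul_transpose, Matrix.vecMul_vecMul, ← Matrix.mul_assoc,
      Matrix.mul_nonsing_inv Aᵀ (Matrix.isUnit_det_transpose A hA), Matrix.one_mul,
      Matrix.dotProduct_mulVec]
  simp only [mardiaKurtosis, sampleCov_mulVec, form]

lemma posSemidef_sampleCov : (sampleCov x N ω).PosSemidef :=
  (Matrix.posSemidef_sum _ fun k _ => by
    simpa using Matrix.posSemidef_vecMulVec_self_star (x k ω)).smul (by positivity)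

lemma sum_mahalanobis_le :
    ∑ n ∈ Finset.Icc 1 N, x n ω ⬝ᵥ ((sampleCov x N ω)⁻¹ *ᵥ x n ω) ≤ p * N := by
  set S := sampleCov x N ω with hS
  rcases Nat.eq_zero_or_pos N with rfl | hN
  · simp
  have sum_eq_trace : ∑ n ∈ Finset.Icc 1 N, x n ω ⬝ᵥ (S⁻¹ *ᵥ x n ω) = N * (S⁻¹ * S).trace := by
    conv_rhs => enter [2, 1, 2]; rw [hS, sampleCov]
    rw [Matrix.mul_smul, Matrix.trace_smul, Matrix.mul_sum, Matrix.trace_sum, smul_eq_mul,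
      ← mul_assoc, mul_one_div_cancel (by positivity), one_mul]
    refine Finset.sum_congr rfl fun n _ => ?_
    rw [Matrix.mul_vecMulVec, Matrix.trace_vecMulVec, dotProduct_comm]
  rw [sum_eq_trace, mul_comm]
  gcongr
  by_cases h : IsUnit S.det
  · simp [Matrix.nonsing_inv_mul S h]
  · simp [Matrix.nonsing_inv_apply_not_isUnit S h]

lemma mardiaKurtosis_nonneg : 0 ≤ mardiaKurtosis x N ω :=
  mul_nonneg (by positivity) (Finset.sum_nonneg fun n _ => sq_nonneg _)

lemma mardiaKurtosis_le : mardiaKurtosis x N ω ≤ p ^ 2 * N := by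
  have nonneg (n : ℕ) : 0 ≤ x n ω ⬝ᵥ ((sampleCov x N ω)⁻¹ *ᵥ x n ω) := by
    simpa using (posSemidef_sampleCov x N ω).inv.dotProduct_mulVec_nonneg (x n ω)
  calc mardiaKurtosis x N ω
      ≤ 1 / N * (∑ n ∈ Finset.Icc 1 N, x n ω ⬝ᵥ ((sampleCov x N ω)⁻¹ *ᵥ x n ω)) ^ 2 := by
        unfold mardiaKurtosis
        gcongr
        exact Finset.sum_sq_le_sq_sum_of_nonneg fun n _ => nonneg n
    _ ≤ 1 / N * (p * N) ^ 2 := by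
        have := Finset.sum_nonneg fun n (_ : n ∈ Finset.Icc 1 N) => nonneg n
        gcongr
        exact sum_mahalanobis_le x N ω
    _ = p ^ 2 * N := by field_simp

variable {x} [MeasurableSpace Ω] {μ : Measure Ω}

lemma memLp_mardiaKurtosis [IsFiniteMeasure μ] (hx : ∀ n a, AEMeasurable (fun ω => x n ω a) μ)
    (q : ENNReal) : MemLp (mardiaKurtosis x N) q μ := by
  have cov (a b : Fin p) : AEMeasurable (fun ω => sampleCov x N ω a b) μ := by
    simp only [sampleCov, Matrix.smul_apply, Matrix.sum_apply, Matrix.vecMulVec_apply, smul_eq_mul]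
    exact (Finset.aemeasurable_fun_sum _ fun (n : ℕ) _ => (hx n a).mul (hx n b)).const_mul _
  refine MemLp.of_bound ?_ (p ^ 2 * N) (ae_of_all _ fun ω => ?_)
  · unfold mardiaKurtosis dotProduct Matrix.mulVec
    have form (n : ℕ) (a b : Fin p) :
        AEMeasurable (fun ω => (sampleCov x N ω)⁻¹ a b * x n ω b) μ :=
      (aemeasurable_inv_apply cov a b).mul (hx n b)
    exact ((Finset.aemeasurable_fun_sum _ fun (n : ℕ) _ => (Finset.aemeasurable_fun_sum _
      fun a _ => (hx n a).mul (Finset.aemeasurable_fun_sum _ fun b _ => form n a b)).pow_const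
      2).const_mul _).aestronglyMeasurable
  · rw [Real.norm_of_nonneg (mardiaKurtosis_nonneg x N ω)]
    exact mardiaKurtosis_le x N ω

end MardiaKurtosis

section FourthCumulant

variable {Ω : Type*} {p : ℕ} (x : ℤ → Ω → Fin p → ℝ) (N : ℕ) (ω : Ω)

/-- The sum over the three pairings of `{i, j, k, l}` of the products of entries of `M`, which is
the fourth moment tensor of a centred Gaussian vector with covariance matrix `M`. -/
def pairingSum (M : Matrix (Fin p) (Fin p) ℝ) (i j k l : Fin p) : ℝ :=
  M i j * M k l + M i k * M j l + M i l * M j k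

/-- The fourth sample cumulant tensor of `x 1, …, x N`, without centring at the sample mean. -/
noncomputable def sampleFourthCumulant (i j k l : Fin p) : ℝ :=
  1 / N * ∑ n ∈ Finset.Icc 1 N, x n ω i * x n ω j * x n ω k * x n ω l
    - pairingSum (sampleCov x N ω) i j k l

lemma sampleCov_apply (i j : Fin p) :
    sampleCov x N ω i j = 1 / N * ∑ n ∈ Finset.Icc 1 N, x n ω i * x n ω j := by
  simp [sampleCov, Matrix.sum_apply, Matrix.vecMulVec_apply]

lemma sampleCov_transpose : (sampleCov x N ω)ᵀ = sampleCov x N ω := by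
  simpa using (posSemidef_sampleCov x N ω).isHermitian.eq

lemma sum_inv_mul_inv_mul_pairingSum {M : Matrix (Fin p) (Fin p) ℝ} (hM : IsUnit M.det)
    (hsymm : Mᵀ = M) :
    ∑ i, ∑ j, ∑ k, ∑ l, M⁻¹ i j * M⁻¹ k l * pairingSum M i j k l = p * (p + 2) := by
  have apply_symm (i j) : M i j = M j i := congrFun (congrFun hsymm j) i
  have inv_symm (i j) : M⁻¹ i j = M⁻¹ j i := by
    rw [← Matrix.transpose_apply M⁻¹, Matrix.transpose_nonsing_inv, hsymm]
  have row (i k) : ∑ j, M⁻¹ i j * M j k = (1 : Matrix (Fin p) (Fin p) ℝ) i k := by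
    rw [← Matrix.nonsing_inv_mul M hM, Matrix.mul_apply]
  have first : ∑ i, ∑ j, ∑ k, ∑ l, M⁻¹ i j * M⁻¹ k l * (M i j * M k l) = p ^ 2 := by
    calc _ = (∑ i, ∑ j, M⁻¹ i j * M j i) * ∑ k, ∑ l, M⁻¹ k l * M l k := by
          simp only [Finset.sum_mul, Finset.mul_sum]
          refine Finset.sum_congr rfl fun i _ => Finset.sum_congr rfl fun j _ =>
            Finset.sum_congr rfl fun k _ => Finset.sum_congr rfl fun l _ => ?_
          rw [apply_symm i j, apply_symm k l]; ring
      _ = _ := by simp [row, sq]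
  have second : ∑ i, ∑ j, ∑ k, ∑ l, M⁻¹ i j * M⁻¹ k l * (M i k * M j l) = p := by
    calc _ = ∑ j, ∑ k, (∑ i, M⁻¹ j i * M i k) * ∑ l, M⁻¹ k l * M l j := by
          rw [Finset.sum_comm]
          refine Finset.sum_congr rfl fun j _ => ?_
          rw [Finset.sum_comm]
          refine Finset.sum_congr rfl fun k _ => ?_
          rw [Finset.sum_mul_sum]
          refine Finset.sum_congr rfl fun i _ => Finset.sum_congr rfl fun l _ => ?_
          rw [inv_symm i j, apply_symm j l]; ring
      _ = _ := by simp [row, Matrix.one_apply]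
  have third : ∑ i, ∑ j, ∑ k, ∑ l, M⁻¹ i j * M⁻¹ k l * (M i l * M j k) = p := by
    rw [← second]
    refine Finset.sum_congr rfl fun i _ => Finset.sum_congr rfl fun j _ => ?_
    rw [Finset.sum_comm]
    refine Finset.sum_congr rfl fun k _ => Finset.sum_congr rfl fun l _ => ?_
    rw [inv_symm k l]
  simp only [pairingSum, mul_add, Finset.sum_add_distrib, first, second, third]
  ring

lemma sq_dotProduct_mulVec (G : Matrix (Fin p) (Fin p) ℝ) (v : Fin p → ℝ) :
    (v ⬝ᵥ (G *ᵥ v)) ^ 2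
      = ∑ i, ∑ j, ∑ k, ∑ l, G i j * G k l * (v i * v j * v k * v l) := by
  simp only [dotProduct, Matrix.mulVec, Finset.mul_sum]
  rw [sq, Finset.sum_mul_sum]
  refine Finset.sum_congr rfl fun i _ => ?_
  simp only [Finset.sum_mul_sum]
  rw [Finset.sum_comm]
  refine Finset.sum_congr rfl fun j _ => Finset.sum_congr rfl fun k _ =>
    Finset.sum_congr rfl fun l _ => ?_
  ring

lemma mardiaKurtosis_eq_add_sum_sampleFourthCumulant (h : IsUnit (sampleCov x N ω).det) :
    mardiaKurtosis x N ω = p * (p + 2) + ∑ i, ∑ j, ∑ k, ∑ l,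
      (sampleCov x N ω)⁻¹ i j * (sampleCov x N ω)⁻¹ k l * sampleFourthCumulant x N ω i j k l := by
  have moments : mardiaKurtosis x N ω = ∑ i, ∑ j, ∑ k, ∑ l,
      (sampleCov x N ω)⁻¹ i j * (sampleCov x N ω)⁻¹ k l *
        (1 / N * ∑ n ∈ Finset.Icc 1 N, x n ω i * x n ω j * x n ω k * x n ω l) := by
    simp only [mardiaKurtosis, sq_dotProduct_mulVec, Finset.mul_sum]
    simp only [Finset.sum_comm (s := Finset.Icc 1 N), mul_left_comm (1 / (N : ℝ))]
  simp only [sampleFourthCumulant, mul_sub, Finset.sum_sub_distrib, ← moments,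
    sum_inv_mul_inv_mul_pairingSum h (sampleCov_transpose x N ω)]
  ring

/-- The fourth sample moment tensor of `x 1, …, x N` with its part explained by the second moments
of a standard Gaussian vector removed: the sample average of the fourth Wick (Hermite) tensor. -/
noncomputable def sampleWickTensor (i j k l : Fin p) : ℝ :=
  sampleFourthCumulant x N ω i j k l + pairingSum (sampleCov x N ω - 1) i j k l

end FourthCumulant

section Expansion

open scoped Matrix.Norms.Operator

lemma norm_sub_one_le_of_one_add_mul_eq_one {R : Type*} [NormedRing R] {e g : R}
    (hg : (1 + e) * g = 1) (he : ‖e‖ ≤ 1 / 2) : ‖g - 1‖ ≤ 2 * ‖e‖ := by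
  have fixed_point : g - 1 = -(e + e * (g - 1)) := by
    rw [mul_sub, mul_one, add_sub_cancel, ← sub_eq_zero, ← sub_eq_zero.2 hg]; noncomm_ring
  have : ‖g - 1‖ ≤ ‖e‖ + ‖e‖ * ‖g - 1‖ := by
    conv_lhs => rw [fixed_point, norm_neg]
    exact (norm_add_le _ _).trans (by gcongr; exact norm_mul_le _ _)
  nlinarith [norm_nonneg (g - 1)]

lemma norm_sub_one_add_le_of_one_add_mul_eq_one {R : Type*} [NormedRing R] {e g : R}
    (hg : (1 + e) * g = 1) (he : ‖e‖ ≤ 1 / 2) : ‖g - 1 + e‖ ≤ 2 * ‖e‖ ^ 2 := by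
  have remainder : g - 1 + e = -(e * (g - 1)) := by
    rw [← sub_eq_zero, ← sub_eq_zero.2 hg]; noncomm_ring
  calc ‖g - 1 + e‖ ≤ ‖e‖ * ‖g - 1‖ := by rw [remainder, norm_neg]; exact norm_mul_le _ _
    _ ≤ ‖e‖ * (2 * ‖e‖) := by gcongr; exact norm_sub_one_le_of_one_add_mul_eq_one hg he
    _ = 2 * ‖e‖ ^ 2 := by ring

variable {p : ℕ} {E : Matrix (Fin p) (Fin p) ℝ} {r : ℝ}

lemma abs_apply_le_linfty_opNorm (E : Matrix (Fin p) (Fin p) ℝ) (i j : Fin p) : |E i j| ≤ ‖E‖ := by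
  rw [Matrix.linfty_opNorm_def, ← Real.norm_eq_abs, ← coe_nnnorm, NNReal.coe_le_coe]
  exact (Finset.single_le_sum (f := fun j => ‖E i j‖₊) (fun _ _ => zero_le)
    (Finset.mem_univ j)).trans (Finset.le_sup (f := fun i => ∑ j, ‖E i j‖₊) (Finset.mem_univ i))

lemma linfty_opNorm_le_of_abs_apply_le (hr : 0 ≤ r) (hE : ∀ i j, |E i j| ≤ r) : ‖E‖ ≤ p * r := by
  lift r to NNReal using hr
  rw [Matrix.linfty_opNorm_def, ← NNReal.coe_natCast, ← NNReal.coe_mul, NNReal.coe_le_coe]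
  refine Finset.sup_le fun i _ => ?_
  simpa using Finset.sum_le_card_nsmul Finset.univ (fun j => ‖E i j‖₊) r fun j _ => hE i j

/-- The Taylor expansion of Mardia's kurtosis at sample covariance `1`, to second order in
the error `E` of the sample covariance and the sample Wick tensor `h`, where `h` itself counts as
a quantity of first order. -/
noncomputable def kurtosisExpansion (E : Matrix (Fin p) (Fin p) ℝ)
    (h : Fin p → Fin p → Fin p → Fin p → ℝ) : ℝ :=
  p * (p + 2) + ∑ i, ∑ j, ∑ k, ∑ l,
    ((1 : Matrix (Fin p) (Fin p) ℝ) i j * (1 : Matrix (Fin p) (Fin p) ℝ) k l *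
        (h i j k l - pairingSum E i j k l)
      - (E i j * (1 : Matrix (Fin p) (Fin p) ℝ) k l
        + (1 : Matrix (Fin p) (Fin p) ℝ) i j * E k l) * h i j k l)

lemma abs_pairingSum_le (hE : ∀ i j, |E i j| ≤ r) (i j k l : Fin p) :
    |pairingSum E i j k l| ≤ 3 * r ^ 2 := by
  have mul_le (i j k l : Fin p) : |E i j * E k l| ≤ r ^ 2 := by
    rw [abs_mul, sq]
    exact mul_le_mul (hE i j) (hE k l) (abs_nonneg _) ((abs_nonneg _).trans (hE i j))
  refine (abs_add_three _ _ _).trans ?_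
  linarith [mul_le i j k l, mul_le i k j l, mul_le i l j k]

lemma abs_mul_mul_sub_expansion_le {d d' e e' g g' h q s r : ℝ} (hr : r ≤ 1 / 2)
    (hd : |d| ≤ 1) (hd' : |d'| ≤ 1) (hg : |g - d| ≤ 2 * r) (hg' : |g' - d'| ≤ 2 * r)
    (hge : |g - d + e| ≤ 2 * r ^ 2) (hge' : |g' - d' + e'| ≤ 2 * r ^ 2)
    (hh : |h| ≤ s) (hq : |q| ≤ 3 * r ^ 2) :
    |g * g' * (h - q) - (d * d' * (h - q) - (e * d' + d * e') * h)| ≤ 18 * (s * r ^ 2 + r ^ 3) := by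
  have r_nonneg : 0 ≤ r := by linarith [abs_nonneg (g - d)]
  have linear : |(g - d + e) * d' + d * (g' - d' + e') + (g - d) * (g' - d')| ≤ 8 * r ^ 2 := by
    calc _ ≤ |g - d + e| * |d'| + |d| * |g' - d' + e'| + |g - d| * |g' - d'| := by
          exact (abs_add_three _ _ _).trans_eq (by simp only [abs_mul])
      _ ≤ 2 * r ^ 2 * 1 + 1 * (2 * r ^ 2) + 2 * r * (2 * r) := by gcongr
      _ = 8 * r ^ 2 := by ring
  have constant : |(g - d) * d' + d * (g' - d') + (g - d) * (g' - d')| ≤ 6 * r := by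
    calc _ ≤ |g - d| * |d'| + |d| * |g' - d'| + |g - d| * |g' - d'| := by
          exact (abs_add_three _ _ _).trans_eq (by simp only [abs_mul])
      _ ≤ 2 * r * 1 + 1 * (2 * r) + 2 * r * (2 * r) := by gcongr
      _ ≤ 6 * r := by nlinarith
  calc _ = |((g - d + e) * d' + d * (g' - d' + e') + (g - d) * (g' - d')) * h
        - ((g - d) * d' + d * (g' - d') + (g - d) * (g' - d')) * q| := by congr 1; ring
    _ ≤ 8 * r ^ 2 * s + 6 * r * (3 * r ^ 2) := by
      refine (abs_sub _ _).trans ?_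
      rw [abs_mul, abs_mul]
      gcongr
    _ ≤ 18 * (s * r ^ 2 + r ^ 3) := by
      nlinarith [mul_nonneg ((abs_nonneg h).trans hh) (sq_nonneg r)]

lemma isUnit_det_one_add (hE : ‖E‖ ≤ 1 / 2) : IsUnit (1 + E).det := by
  rw [← Matrix.isUnit_iff_isUnit_det, ← sub_neg_eq_add]
  exact isUnit_one_sub_of_norm_lt_one (by rw [norm_neg]; linarith)

lemma abs_one_apply_le (i j : Fin p) : |(1 : Matrix (Fin p) (Fin p) ℝ) i j| ≤ 1 := by
  rw [Matrix.one_apply]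
  split_ifs <;> simp

lemma abs_sum_sum_sum_sum_le {f : Fin p → Fin p → Fin p → Fin p → ℝ} {c : ℝ}
    (hf : ∀ i j k l, |f i j k l| ≤ c) : |∑ i, ∑ j, ∑ k, ∑ l, f i j k l| ≤ p ^ 4 * c := by
  have sum_le {g : Fin p → ℝ} {b : ℝ} (hg : ∀ i, |g i| ≤ b) : |∑ i, g i| ≤ p * b :=
    (Finset.abs_sum_le_sum_abs _ _).trans <| by
      simpa using Finset.sum_le_card_nsmul Finset.univ (fun i => |g i|) b fun i _ => hg i
  calc _ ≤ p * (p * (p * (p * c))) :=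
        sum_le fun i => sum_le fun j => sum_le fun k => sum_le fun l => hf i j k l
    _ = p ^ 4 * c := by ring

lemma abs_sum_inv_mul_inv_sub_kurtosisExpansion_le {h : Fin p → Fin p → Fin p → Fin p → ℝ} {s : ℝ}
    (hE : ‖E‖ ≤ r) (hr : r ≤ 1 / 2) (hh : ∀ i j k l, |h i j k l| ≤ s) :
    |p * (p + 2) + ∑ i, ∑ j, ∑ k, ∑ l, (1 + E)⁻¹ i j * (1 + E)⁻¹ k l *
        (h i j k l - pairingSum E i j k l) - kurtosisExpansion E h|
      ≤ p ^ 4 * (18 * (s * r ^ 2 + r ^ 3)) := by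
  have inv_eq := Matrix.mul_nonsing_inv _ (isUnit_det_one_add (hE.trans hr))
  have first_order (i j) : |(1 + E)⁻¹ i j - (1 : Matrix (Fin p) (Fin p) ℝ) i j| ≤ 2 * r :=
    (abs_apply_le_linfty_opNorm ((1 + E)⁻¹ - 1) i j).trans
      ((norm_sub_one_le_of_one_add_mul_eq_one inv_eq (hE.trans hr)).trans (by gcongr))
  have second_order (i j) :
      |(1 + E)⁻¹ i j - (1 : Matrix (Fin p) (Fin p) ℝ) i j + E i j| ≤ 2 * r ^ 2 :=
    (abs_apply_le_linfty_opNorm ((1 + E)⁻¹ - 1 + E) i j).trans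
      ((norm_sub_one_add_le_of_one_add_mul_eq_one inv_eq (hE.trans hr)).trans (by gcongr))
  rw [kurtosisExpansion, add_sub_add_left_eq_sub]
  simp only [← Finset.sum_sub_distrib]
  exact abs_sum_sum_sum_sum_le fun i j k l => abs_mul_mul_sub_expansion_le hr
    (abs_one_apply_le i j) (abs_one_apply_le k l) (first_order i j) (first_order k l)
    (second_order i j) (second_order k l) (hh i j k l)
    (abs_pairingSum_le (fun i j => (abs_apply_le_linfty_opNorm E i j).trans hE) i j k l)

lemma abs_kurtosisExpansion_sub_le {h : Fin p → Fin p → Fin p → Fin p → ℝ} {s : ℝ}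
    (hE : ∀ i j, |E i j| ≤ r) (hh : ∀ i j k l, |h i j k l| ≤ s) :
    |kurtosisExpansion E h - p * (p + 2)| ≤ p ^ 4 * (s + 3 * r ^ 2 + 2 * (s * r)) := by
  rw [kurtosisExpansion, add_sub_cancel_left]
  refine abs_sum_sum_sum_sum_le fun i j k l => ?_
  have r_nonneg : 0 ≤ r := (abs_nonneg _).trans (hE i j)
  have : 0 ≤ s := (abs_nonneg _).trans (hh i j k l)
  calc _ ≤ |(1 : Matrix (Fin p) (Fin p) ℝ) i j| * |(1 : Matrix (Fin p) (Fin p) ℝ) k l| *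
          (|h i j k l| + |pairingSum E i j k l|)
        + (|E i j| * |(1 : Matrix (Fin p) (Fin p) ℝ) k l|
          + |(1 : Matrix (Fin p) (Fin p) ℝ) i j| * |E k l|) * |h i j k l| := by
        refine (abs_sub _ _).trans ?_
        rw [abs_mul, abs_mul, abs_mul]
        gcongr
        · exact abs_sub _ _
        · exact (abs_add_le _ _).trans_eq (by rw [abs_mul, abs_mul])
    _ ≤ 1 * 1 * (s + 3 * r ^ 2) + (r * 1 + 1 * r) * s := by
        have := abs_one_apply_le i j
        have := abs_one_apply_le k l
        have := abs_pairingSum_le hE i j k l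
        gcongr <;> first | exact hh i j k l | exact hE _ _
    _ = s + 3 * r ^ 2 + 2 * (s * r) := by ring

variable {Ω : Type*} {x : ℤ → Ω → Fin p → ℝ} {N : ℕ} {ω : Ω} {s : ℝ}

lemma abs_mardiaKurtosis_sub_kurtosisExpansion_le_of_le_half
    (hE : ‖sampleCov x N ω - 1‖ ≤ r) (hr : r ≤ 1 / 2)
    (hh : ∀ i j k l, |sampleWickTensor x N ω i j k l| ≤ s) :
    |mardiaKurtosis x N ω - kurtosisExpansion (sampleCov x N ω - 1) (sampleWickTensor x N ω)|
      ≤ p ^ 4 * (18 * (s * r ^ 2 + r ^ 3)) := by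
  have expansion := abs_sum_inv_mul_inv_sub_kurtosisExpansion_le hE hr hh
  have unit := isUnit_det_one_add (hE.trans hr)
  simp only [sampleWickTensor, add_sub_cancel_right, add_sub_cancel] at expansion unit
  rwa [← mardiaKurtosis_eq_add_sum_sampleFourthCumulant x N ω unit] at expansion

/- The crude bound `p ^ 2 * N` on the kurtosis is absorbed by the term `N * r ^ 6`, which still has
small moments. -/
lemma abs_mardiaKurtosis_sub_kurtosisExpansion_le_of_half_lt (hN : 1 ≤ N)
    (hE : ‖sampleCov x N ω - 1‖ ≤ r) (hr : 1 / 2 < r)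
    (hh : ∀ i j k l, |sampleWickTensor x N ω i j k l| ≤ s) (hs : 0 ≤ s) :
    |mardiaKurtosis x N ω - kurtosisExpansion (sampleCov x N ω - 1) (sampleWickTensor x N ω)|
      ≤ 64 * (p ^ 2 + p * (p + 2)) * (N * r ^ 6) + 18 * p ^ 4 * (s * r ^ 2 + r ^ 3) := by
  have one_le : (1 : ℝ) ≤ N := by exact_mod_cast hN
  have N_le : N ≤ 64 * (N * r ^ 6) := by
    have : (1 / 2 : ℝ) ^ 6 ≤ r ^ 6 := by gcongr
    nlinarith
  have kurtosis_le : |mardiaKurtosis x N ω| ≤ p ^ 2 * (64 * (N * r ^ 6)) := by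
    rw [abs_of_nonneg (mardiaKurtosis_nonneg x N ω)]
    exact (mardiaKurtosis_le x N ω).trans (by gcongr)
  have constant_le : |(p * (p + 2) : ℝ)| ≤ p * (p + 2) * (64 * (N * r ^ 6)) := by
    rw [abs_of_nonneg (by positivity)]
    exact le_mul_of_one_le_right (by positivity) (one_le.trans N_le)
  have linear_le : s + 3 * r ^ 2 + 2 * (s * r) ≤ 18 * (s * r ^ 2 + r ^ 3) := by
    nlinarith [mul_nonneg hs (sub_nonneg.2 hr.le), mul_nonneg (sq_nonneg r) (sub_nonneg.2 hr.le),
      mul_nonneg (mul_nonneg hs (sub_nonneg.2 hr.le)) (sub_nonneg.2 hr.le)]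
  have expansion_le := (abs_kurtosisExpansion_sub_le (E := sampleCov x N ω - 1)
    (fun i j => (abs_apply_le_linfty_opNorm _ i j).trans hE) hh).trans
    (mul_le_mul_of_nonneg_left linear_le (by positivity))
  generalize kurtosisExpansion (sampleCov x N ω - 1) _ = expansion at *
  calc |mardiaKurtosis x N ω - expansion|
      = |mardiaKurtosis x N ω - p * (p + 2) - (expansion - p * (p + 2))| := by congr 1; ring
    _ ≤ |mardiaKurtosis x N ω| + |(p * (p + 2) : ℝ)| + |expansion - p * (p + 2)| :=
      (abs_sub _ _).trans (by gcongr; exact abs_sub _ _)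
    _ ≤ p ^ 2 * (64 * (N * r ^ 6)) + p * (p + 2) * (64 * (N * r ^ 6))
        + p ^ 4 * (18 * (s * r ^ 2 + r ^ 3)) := by gcongr
    _ = _ := by ring

lemma abs_mardiaKurtosis_sub_kurtosisExpansion_le (hN : 1 ≤ N)
    (hE : ‖sampleCov x N ω - 1‖ ≤ r) (hh : ∀ i j k l, |sampleWickTensor x N ω i j k l| ≤ s)
    (hs : 0 ≤ s) :
    |mardiaKurtosis x N ω - kurtosisExpansion (sampleCov x N ω - 1) (sampleWickTensor x N ω)|
      ≤ (64 * (p ^ 2 + p * (p + 2)) + 18 * p ^ 4) * (s * r ^ 2 + r ^ 3 + N * r ^ 6) := by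
  have r_nonneg : 0 ≤ r := (norm_nonneg _).trans hE
  have bound : 64 * (p ^ 2 + p * (p + 2)) * (N * r ^ 6) + 18 * p ^ 4 * (s * r ^ 2 + r ^ 3)
      ≤ (64 * (p ^ 2 + p * (p + 2)) + 18 * p ^ 4) * (s * r ^ 2 + r ^ 3 + N * r ^ 6) := by
    have : 0 ≤ 18 * (p : ℝ) ^ 4 * (N * r ^ 6) := by positivity
    have : 0 ≤ 64 * ((p : ℝ) ^ 2 + p * (p + 2)) * (s * r ^ 2 + r ^ 3) := by positivity
    linarith
  refine le_trans ?_ bound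
  rcases le_or_gt r (1 / 2) with hr | hr
  · refine (abs_mardiaKurtosis_sub_kurtosisExpansion_le_of_le_half hE hr hh).trans ?_
    calc _ = 0 + 18 * p ^ 4 * (s * r ^ 2 + r ^ 3) := by ring
      _ ≤ _ := by gcongr; positivity
  · exact abs_mardiaKurtosis_sub_kurtosisExpansion_le_of_half_lt hN hE hr hh hs

end Expansion

section WickTensor

variable {Ω κ : Type*} {p : ℕ} (x : ℤ → Ω → Fin p → ℝ) {N : ℕ} (ω : Ω)

lemma timeAverage_sub_const (f : ℤ → ℝ) (c : ℝ) (hN : 1 ≤ N) :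
    timeAverage (fun n => f n - c) N = timeAverage f N - c := by
  have : (N : ℝ) ≠ 0 := by positivity
  simp only [timeAverage, Finset.sum_sub_distrib, Finset.sum_const, Nat.card_Icc,
    add_tsub_cancel_right, nsmul_eq_mul]
  field_simp

lemma timeAverage_sq_dotProduct (v : Fin p → ℝ) :
    timeAverage (fun n => (v ⬝ᵥ x n ω) ^ 2) N = v ⬝ᵥ (sampleCov x N ω *ᵥ v) := by
  simp only [timeAverage, dotProduct, Matrix.mulVec, sampleCov_apply, sq, Finset.mul_sum,
    Finset.sum_mul]
  rw [Finset.sum_comm]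
  refine Finset.sum_congr rfl fun i _ => ?_
  rw [Finset.sum_comm]
  refine Finset.sum_congr rfl fun j _ => Finset.sum_congr rfl fun n _ => ?_
  ring

lemma wickAverage_two_mulVec (V : Matrix κ (Fin p) ℝ) (hN : 1 ≤ N) (k : κ) :
    wickAverage (fun n ω => V *ᵥ x n ω) (V * Vᵀ).diag 2 N ω k
      = V k ⬝ᵥ ((sampleCov x N ω - 1) *ᵥ V k) := by
  rw [Matrix.sub_mulVec, Matrix.one_mulVec, dotProduct_sub, ← timeAverage_sq_dotProduct,
    ← timeAverage_sub_const _ _ hN]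
  simp only [wickAverage, eval_wickPolynomial_two]
  rfl

/-- The value on the diagonal `(v, v, v, v)` of the quartic form with coefficients `h`. -/
def quarticForm (h : Fin p → Fin p → Fin p → Fin p → ℝ) (v : Fin p → ℝ) : ℝ :=
  ∑ i, ∑ j, ∑ k, ∑ l, h i j k l * (v i * v j * v k * v l)

lemma quarticForm_pairingSum (M : Matrix (Fin p) (Fin p) ℝ) (v : Fin p → ℝ) :
    quarticForm (pairingSum M) v = 3 * (v ⬝ᵥ (M *ᵥ v)) ^ 2 := by
  have first : ∑ i, ∑ j, ∑ k, ∑ l, M i j * M k l * (v i * v j * v k * v l)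
      = (v ⬝ᵥ (M *ᵥ v)) ^ 2 := (sq_dotProduct_mulVec M v).symm
  have second : ∑ i, ∑ j, ∑ k, ∑ l, M i k * M j l * (v i * v j * v k * v l)
      = (v ⬝ᵥ (M *ᵥ v)) ^ 2 := by
    rw [← first]
    refine Finset.sum_congr rfl fun i _ => ?_
    rw [Finset.sum_comm]
    simp only [mul_right_comm (v i)]
  have third : ∑ i, ∑ j, ∑ k, ∑ l, M i l * M j k * (v i * v j * v k * v l)
      = (v ⬝ᵥ (M *ᵥ v)) ^ 2 := by
    rw [← second]
    refine Finset.sum_congr rfl fun i _ => Finset.sum_congr rfl fun j _ => ?_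
    rw [Finset.sum_comm]
    simp only [mul_right_comm (v i * v j)]
  simp only [quarticForm, pairingSum, add_mul, Finset.sum_add_distrib, first, second, third]
  ring

lemma quarticForm_sampleWickTensor (v : Fin p → ℝ) :
    quarticForm (sampleWickTensor x N ω) v = timeAverage (fun n => (v ⬝ᵥ x n ω) ^ 4) N
      - 3 * (v ⬝ᵥ (sampleCov x N ω *ᵥ v)) ^ 2 + 3 * (v ⬝ᵥ ((sampleCov x N ω - 1) *ᵥ v)) ^ 2 := by
  have pow_four (n : ℤ) : (v ⬝ᵥ x n ω) ^ 4
      = ∑ i, ∑ j, ∑ k, ∑ l, x n ω i * x n ω j * x n ω k * x n ω l * (v i * v j * v k * v l) := by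
    have := sq_dotProduct_mulVec (Matrix.vecMulVec (x n ω) (x n ω)) v
    rw [Matrix.vecMulVec_mulVec, op_smul_eq_smul, dotProduct_smul, smul_eq_mul,
      dotProduct_comm (x n ω), ← sq, ← pow_mul] at this
    simpa only [Matrix.vecMulVec_apply, mul_assoc] using this
  have moment : quarticForm (fun i j k l => 1 / N * ∑ n ∈ Finset.Icc 1 N,
      x n ω i * x n ω j * x n ω k * x n ω l) v = timeAverage (fun n => (v ⬝ᵥ x n ω) ^ 4) N := by
    simp only [quarticForm, timeAverage, pow_four, Finset.mul_sum, Finset.sum_mul, mul_assoc,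
      Finset.sum_comm (s := Finset.Icc 1 N)]
  rw [← moment, ← quarticForm_pairingSum, ← quarticForm_pairingSum]
  simp only [quarticForm, sampleWickTensor, sampleFourthCumulant, add_mul, sub_mul,
    Finset.sum_add_distrib, Finset.sum_sub_distrib]

lemma wickAverage_four_mulVec (V : Matrix κ (Fin p) ℝ) (hN : 1 ≤ N) (k : κ) :
    wickAverage (fun n ω => V *ᵥ x n ω) (V * Vᵀ).diag 4 N ω k
      = quarticForm (sampleWickTensor x N ω) (V k) := by
  have N_ne_zero : (N : ℝ) ≠ 0 := by positivity
  have expand : wickAverage (fun n ω => V *ᵥ x n ω) (V * Vᵀ).diag 4 N ω k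
      = timeAverage (fun n => (V k ⬝ᵥ x n ω) ^ 4) N
        - 6 * (V k ⬝ᵥ V k) * (V k ⬝ᵥ (sampleCov x N ω *ᵥ V k)) + 3 * (V k ⬝ᵥ V k) ^ 2 := by
    change timeAverage (fun n => (wickPolynomial (V k ⬝ᵥ V k) 4).eval (V k ⬝ᵥ x n ω)) N = _
    rw [← timeAverage_sq_dotProduct]
    simp only [eval_wickPolynomial_four, timeAverage, Finset.sum_add_distrib,
      Finset.sum_sub_distrib, ← Finset.mul_sum, Finset.sum_const, Nat.card_Icc,
      add_tsub_cancel_right, nsmul_eq_mul]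
    field_simp
  rw [expand, quarticForm_sampleWickTensor, Matrix.sub_mulVec, Matrix.one_mulVec, dotProduct_sub]
  ring

/-- Invariance of a tensor of rank four under all permutations of its indices. -/
structure IsSymmetricTensor (h : Fin p → Fin p → Fin p → Fin p → ℝ) : Prop where
  comm_left (i j k l : Fin p) : h i j k l = h j i k l
  comm_middle (i j k l : Fin p) : h i j k l = h i k j l
  comm_right (i j k l : Fin p) : h i j k l = h i j l k

lemma isSymmetricTensor_pairingSum {M : Matrix (Fin p) (Fin p) ℝ} (hM : Mᵀ = M) :
    IsSymmetricTensor (pairingSum M) := by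
  have comm (i j) : M i j = M j i := congrFun (congrFun hM j) i
  refine ⟨fun i j k l => ?_, fun i j k l => ?_, fun i j k l => ?_⟩
  · rw [pairingSum, pairingSum, comm i j]; ring
  · rw [pairingSum, pairingSum, comm j k]; ring
  · rw [pairingSum, pairingSum, comm k l]; ring

lemma isSymmetricTensor_sampleWickTensor : IsSymmetricTensor (sampleWickTensor x N ω) := by
  have cov := isSymmetricTensor_pairingSum (sampleCov_transpose x N ω)
  have error : IsSymmetricTensor (pairingSum (sampleCov x N ω - 1)) :=
    isSymmetricTensor_pairingSum (by simp [sampleCov_transpose])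
  refine ⟨fun i j k l => ?_, fun i j k l => ?_, fun i j k l => ?_⟩ <;>
    unfold sampleWickTensor sampleFourthCumulant
  · rw [cov.comm_left, error.comm_left]
    simp only [mul_comm (x _ ω i)]
  · rw [cov.comm_middle, error.comm_middle]
    simp only [mul_right_comm _ (x _ ω j)]
  · rw [cov.comm_right, error.comm_right]
    simp only [mul_right_comm _ (x _ ω k)]

end WickTensor

section WickExpansion

/-- The error term of an expansion in time averages `D`, `A` of the second and fourth Wick powers:
these averages are of size `N^(-1/2)`, so that it is of size `N^(-3/2)`. -/
def wickRemainder {κ : Type*} [Fintype κ] (D A : κ → ℝ) (N : ℕ) : ℝ :=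
  ‖A‖ * ‖D‖ ^ 2 + ‖D‖ ^ 3 + N * ‖D‖ ^ 6

/-- The statistics `M N` are approximated by `c + t ⬝ A - D ⬝ Q D + D ⬝ B A`, where `D` and `A` are
the time averages of the second and fourth Wick powers of `x`. The matrix `B` is not recorded:
Wick powers of different degrees are uncorrelated, so it does not contribute at order `1/N`. -/
def HasWickExpansion {Ω κ : Type*} [Fintype κ] (M : ℕ → Ω → ℝ) (x : ℤ → Ω → κ → ℝ) (s : κ → ℝ)
    (c : ℝ) (t : κ → ℝ) (Q : Matrix κ κ ℝ) : Prop :=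
  ∃ (B : Matrix κ κ ℝ) (K : ℝ), ∀ N ω (D A : κ → ℝ), 1 ≤ N → D = wickAverage x s 2 N ω →
    A = wickAverage x s 4 N ω →
    |M N ω - (c + t ⬝ᵥ A - D ⬝ᵥ (Q *ᵥ D) + D ⬝ᵥ (B *ᵥ A))| ≤ K * wickRemainder D A N

end WickExpansion

section Planar

/-- Five directions of the plane whose squares and fourth powers span the quadratic and the quartic
forms in two variables. -/
def directions : Matrix (Fin 5) (Fin 2) ℝ := !![1, 0; 0, 1; 1, 1; 1, -1; 1, 2]

/-- The coefficients of the trace `h₁₁₁₁ + 2 h₁₁₂₂ + h₂₂₂₂` of a quartic form in its values at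
`directions`. -/
noncomputable def traceCoeff : Fin 5 → ℝ := ![2/3, 2/3, 1/6, 1/6, 0]

/-- The coefficients of `(tr E)² + 2 tr(E²)` in the values at `directions` of the quadratic form of
a symmetric matrix `E`. -/
def quadraticCoeff : Matrix (Fin 5) (Fin 5) ℝ :=
  !![4, 4, 0, 0, 0; 0, 4, 0, 0, 0; -2, -2, 1, 0, 0; 0, 0, 0, 0, 0; 0, 0, 0, 0, 0]

section Polarization

lemma exists_apply_eq_dotProduct_quadraticForm_directions : ∃ c : Fin 2 → Fin 2 → Fin 5 → ℝ,
    ∀ E : Matrix (Fin 2) (Fin 2) ℝ, Eᵀ = E → ∀ i j,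
      E i j = c i j ⬝ᵥ fun m => directions m ⬝ᵥ (E *ᵥ directions m) := by
  refine ⟨fun i j => ![![![1, 0, 0, 0, 0], ![-1/2, -1/2, 1/2, 0, 0]],
    ![![-1/2, -1/2, 1/2, 0, 0], ![0, 1, 0, 0, 0]]] i j, fun E hE i j => ?_⟩
  have comm : E 1 0 = E 0 1 := congrFun (congrFun hE 0) 1
  fin_cases i <;> fin_cases j <;>
    simp [directions, dotProduct, Matrix.mulVec, Fin.sum_univ_succ, comm] <;> ring

lemma IsSymmetricTensor.exists_eq_apply_add
    {h : Fin 2 → Fin 2 → Fin 2 → Fin 2 → ℝ} (hh : IsSymmetricTensor h) :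
    ∃ c : Fin 5 → ℝ, ∀ i j k l : Fin 2,
      h i j k l = c ⟨i.val + j.val + k.val + l.val, by omega⟩ := by
  refine ⟨![h 0 0 0 0, h 0 0 0 1, h 0 0 1 1, h 0 1 1 1, h 1 1 1 1], fun i j k l => ?_⟩
  have := hh.comm_left 1 0
  have := hh.comm_middle
  have := hh.comm_right
  fin_cases i <;> fin_cases j <;> fin_cases k <;> fin_cases l <;> simp <;> grind

lemma exists_apply_eq_dotProduct_quarticForm_directions :
    ∃ c : Fin 2 → Fin 2 → Fin 2 → Fin 2 → Fin 5 → ℝ,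
    ∀ h, IsSymmetricTensor h → ∀ i j k l,
      h i j k l = c i j k l ⬝ᵥ fun m => quarticForm h (directions m) := by
  -- The inverse of the matrix of values of `x⁴, 4 x³ y, 6 x² y², 4 x y³, y⁴` along `directions`.
  refine ⟨fun i j k l => (![![1, 0, 0, 0, 0], ![-1/8, 1/2, 1/4, -1/12, -1/24],
    ![-1/6, -1/6, 1/12, 1/12, 0], ![1/8, -1/2, -1/8, -1/24, 1/24], ![0, 1, 0, 0, 0]]
      : Fin 5 → Fin 5 → ℝ) ⟨i.val + j.val + k.val + l.val, by omega⟩, fun h hh i j k l => ?_⟩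
  obtain ⟨c, hc⟩ := hh.exists_eq_apply_add
  simp only [hc]
  generalize (⟨i.val + j.val + k.val + l.val, _⟩ : Fin 5) = m
  fin_cases m <;>
    simp [directions, quarticForm, hc, dotProduct, Fin.sum_univ_succ] <;> ring

lemma exists_kurtosisExpansion_eq : ∃ B : Matrix (Fin 5) (Fin 5) ℝ,
    ∀ (E : Matrix (Fin 2) (Fin 2) ℝ) (h : Fin 2 → Fin 2 → Fin 2 → Fin 2 → ℝ), Eᵀ = E →
      IsSymmetricTensor h → ∀ (D A : Fin 5 → ℝ),
      (∀ m, D m = directions m ⬝ᵥ (E *ᵥ directions m)) →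
      (∀ m, A m = quarticForm h (directions m)) →
      kurtosisExpansion E h
        = 8 + traceCoeff ⬝ᵥ A - D ⬝ᵥ (quadraticCoeff *ᵥ D) + D ⬝ᵥ (B *ᵥ A) := by
  -- `D ⬝ᵥ (B *ᵥ A)` is `-2 ∑ E i j * h i j k k` with `E` and `h` expressed through `D` and `A`.
  refine ⟨!![-5/3, 1/3, 1/12, -5/12, 0; 1/3, -5/3, 1/12, -5/12, 0; 0, 0, -1/4, 1/4, 0;
    0, 0, 0, 0, 0; 0, 0, 0, 0, 0], fun E h hE hh D A hD hA => ?_⟩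
  obtain ⟨c, hc⟩ := hh.exists_eq_apply_add
  have comm : E 1 0 = E 0 1 := congrFun (congrFun hE 0) 1
  simp [kurtosisExpansion, pairingSum, hD, hA, directions, traceCoeff, quadraticCoeff, quarticForm,
    hc, dotProduct, Matrix.mulVec, Fin.sum_univ_succ, comm]
  ring

end Polarization

lemma abs_dotProduct_le {κ : Type*} [Fintype κ] (c F : κ → ℝ) :
    |c ⬝ᵥ F| ≤ (∑ m, |c m|) * ‖F‖ := by
  rw [Finset.sum_mul]
  refine (Finset.abs_sum_le_sum_abs _ _).trans (Finset.sum_le_sum fun m _ => ?_)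
  rw [abs_mul]
  gcongr
  exact norm_le_pi_norm F m

lemma exists_abs_dotProduct_le {ι κ : Type*} [Finite ι] [Fintype κ] (c : ι → κ → ℝ) :
    ∃ C, 0 ≤ C ∧ ∀ i F, |c i ⬝ᵥ F| ≤ C * ‖F‖ := by
  obtain ⟨C, hC⟩ := Finite.exists_le fun i => ∑ m, |c i m|
  refine ⟨max C 0, le_max_right _ _, fun i F => (abs_dotProduct_le _ _).trans ?_⟩
  gcongr
  exact (hC i).trans (le_max_left _ _)

lemma hasWickExpansion_mardiaKurtosis {Ω : Type*} (x : ℤ → Ω → Fin 2 → ℝ) :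
    HasWickExpansion (mardiaKurtosis x) (fun n ω => directions *ᵥ x n ω)
      (directions * directionsᵀ).diag 8 traceCoeff quadraticCoeff := by
  obtain ⟨B, hB⟩ := exists_kurtosisExpansion_eq
  obtain ⟨e, he⟩ := exists_apply_eq_dotProduct_quadraticForm_directions
  obtain ⟨η, hη⟩ := exists_apply_eq_dotProduct_quarticForm_directions
  obtain ⟨a, ha, e_le⟩ := exists_abs_dotProduct_le fun ij : Fin 2 × Fin 2 => e ij.1 ij.2
  obtain ⟨b, hb, η_le⟩ := exists_abs_dotProduct_le
    fun m : Fin 2 × Fin 2 × Fin 2 × Fin 2 => η m.1 m.2.1 m.2.2.1 m.2.2.2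
  refine ⟨B, (64 * ((2 : ℕ) ^ 2 + (2 : ℕ) * ((2 : ℕ) + 2)) + 18 * (2 : ℕ) ^ 4) *
    (b * (2 * a) ^ 2 + (2 * a) ^ 3 + (2 * a) ^ 6), fun N ω D A hN hD hA => ?_⟩
  have symm : (sampleCov x N ω - 1)ᵀ = sampleCov x N ω - 1 := by simp [sampleCov_transpose]
  have D_apply m : D m = directions m ⬝ᵥ ((sampleCov x N ω - 1) *ᵥ directions m) := by
    rw [hD, wickAverage_two_mulVec _ _ _ hN]
  have A_apply m : A m = quarticForm (sampleWickTensor x N ω) (directions m) := by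
    rw [hA, wickAverage_four_mulVec _ _ _ hN]
  have error_le i j : |(sampleCov x N ω - 1) i j| ≤ a * ‖D‖ := by
    rw [he _ symm, ← funext D_apply]
    exact e_le (i, j) D
  have tensor_le i j k l : |sampleWickTensor x N ω i j k l| ≤ b * ‖A‖ := by
    rw [hη _ (isSymmetricTensor_sampleWickTensor x ω), ← funext A_apply]
    exact η_le (i, j, k, l) A
  have norm_le := linfty_opNorm_le_of_abs_apply_le (by positivity) error_le
  rw [← hB _ _ symm (isSymmetricTensor_sampleWickTensor x ω) D A D_apply A_apply, mul_assoc]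
  refine (abs_mardiaKurtosis_sub_kurtosisExpansion_le hN norm_le tensor_le
    (by positivity)).trans (mul_le_mul_of_nonneg_left ?_ (by positivity))
  have first : 0 ≤ (b * (2 * a) ^ 2) * (‖D‖ ^ 3 + N * ‖D‖ ^ 6) := by positivity
  have second : 0 ≤ (2 * a) ^ 3 * (‖A‖ * ‖D‖ ^ 2 + N * ‖D‖ ^ 6) := by positivity
  have third : 0 ≤ (2 * a) ^ 6 * (‖A‖ * ‖D‖ ^ 2 + ‖D‖ ^ 3) := by positivity
  rw [wickRemainder]
  push_cast
  linarith

end Planar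

section SecondMomentRates

variable {Ω : Type*} [MeasurableSpace Ω] {μ : Measure Ω}

lemma sq_integral_mul_le {f g : Ω → ℝ} (hf : MemLp f 2 μ) (hg : MemLp g 2 μ) :
    (∫ ω, f ω * g ω ∂μ) ^ 2 ≤ (∫ ω, f ω ^ 2 ∂μ) * ∫ ω, g ω ^ 2 ∂μ := by
  have quadratic (t : ℝ) : 0 ≤ (∫ ω, f ω ^ 2 ∂μ) * (t * t) + (2 * ∫ ω, f ω * g ω ∂μ) * t
      + ∫ ω, g ω ^ 2 ∂μ := by
    calc 0 ≤ ∫ ω, (t * t) * f ω ^ 2 + (2 * t) * (f ω * g ω) + g ω ^ 2 ∂μ :=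
          integral_nonneg fun ω => (sq_nonneg (t * f ω + g ω)).trans_eq (by ring)
      _ = _ := by
          have hff : Integrable (fun ω => t * t * f ω ^ 2) μ := hf.integrable_sq.const_mul _
          have hfg : Integrable (fun ω => 2 * t * (f ω * g ω)) μ :=
            (hf.integrable_mul hg).const_mul _
          rw [integral_add _ hg.integrable_sq, integral_add hff hfg, integral_const_mul,
            integral_const_mul]
          · ring
          · exact hff.add hfg
  have discriminant := discrim_le_zero quadratic
  rw [discrim] at discriminant
  linarith

lemma sq_covariance_le [IsProbabilityMeasure μ] {X Y : Ω → ℝ} (hX : MemLp X 2 μ)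
    (hY : MemLp Y 2 μ) : cov[X, Y; μ] ^ 2 ≤ variance X μ * variance Y μ := by
  rw [variance_eq_integral hX.aemeasurable, variance_eq_integral hY.aemeasurable]
  exact sq_integral_mul_le (hX.sub (memLp_const _)) (hY.sub (memLp_const _))

lemma isLittleO_variance_add_sub [IsProbabilityMeasure μ] {X Y : ℕ → Ω → ℝ} {a : ℕ → ℝ}
    (hX : ∀ N, MemLp (X N) 2 μ) (hY : ∀ N, MemLp (Y N) 2 μ)
    (hXa : (fun N => variance (X N) μ) =O[atTop] a)
    (hYa : (fun N => variance (Y N) μ) =o[atTop] a) :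
    (fun N => variance (X N + Y N) μ - variance (X N) μ) =o[atTop] a := by
  have covariance_sq : (fun N => cov[X N, Y N; μ] ^ 2) =o[atTop] fun N => a N ^ 2 := by
    refine (IsBigO.of_bound 1 (Eventually.of_forall fun N => ?_)).trans_isLittleO
      ((hXa.mul_isLittleO hYa).congr_right fun N => (sq (a N)).symm)
    rw [one_mul, Real.norm_of_nonneg (sq_nonneg _)]
    exact (sq_covariance_le (hX N) (hY N)).trans (le_abs_self _)
  refine (((covariance_sq.of_pow two_ne_zero).const_mul_left 2).add hYa).congr_left fun N => ?_
  rw [variance_add (hX N) (hY N)]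
  ring

lemma isBigO_integral_mul {f g : ℕ → Ω → ℝ} {a b : ℕ → ℝ} (hf : ∀ N, MemLp (f N) 2 μ)
    (hg : ∀ N, MemLp (g N) 2 μ) (hfa : (fun N => ∫ ω, f N ω ^ 2 ∂μ) =O[atTop] fun N => a N ^ 2)
    (hgb : (fun N => ∫ ω, g N ω ^ 2 ∂μ) =O[atTop] fun N => b N ^ 2) :
    (fun N => ∫ ω, f N ω * g N ω ∂μ) =O[atTop] fun N => a N * b N := by
  refine IsBigO.of_pow two_ne_zero ((IsBigO.of_bound 1 (Eventually.of_forall fun N => ?_)).trans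
    ((hfa.mul hgb).congr_right fun N => (mul_pow _ _ _).symm))
  rw [one_mul, Pi.pow_apply, Real.norm_of_nonneg (sq_nonneg _)]
  exact (sq_integral_mul_le (hf N) (hg N)).trans (le_abs_self _)

lemma isBigO_integral_sq_add {f g : ℕ → Ω → ℝ} {a : ℕ → ℝ} (hf : ∀ N, MemLp (f N) 2 μ)
    (hg : ∀ N, MemLp (g N) 2 μ) (hfa : (fun N => ∫ ω, f N ω ^ 2 ∂μ) =O[atTop] a)
    (hga : (fun N => ∫ ω, g N ω ^ 2 ∂μ) =O[atTop] a) :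
    (fun N => ∫ ω, (f N ω + g N ω) ^ 2 ∂μ) =O[atTop] a := by
  refine (IsBigO.of_bound 2 (Eventually.of_forall fun N => ?_)).trans (hfa.add hga)
  rw [Real.norm_of_nonneg (integral_nonneg fun ω => sq_nonneg _),
    ← integral_add (hf N).integrable_sq (hg N).integrable_sq,
    Real.norm_of_nonneg (integral_nonneg fun ω => by positivity), ← integral_const_mul]
  exact integral_mono ((hf N).add (hg N)).integrable_sq
    (((hf N).integrable_sq.add (hg N).integrable_sq).const_mul 2) fun ω => add_sq_le

lemma isBigO_integral_norm_pow {κ : Type*} [Fintype κ] [IsProbabilityMeasure μ]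
    {F : ℕ → Ω → κ → ℝ} {a : ℕ → ℝ} {p : ℕ} (hF : ∀ N k, HasAllMoments (fun ω => F N ω k) μ)
    (hp : Even p) (hp0 : p ≠ 0) (hFa : ∀ k, (fun N => ∫ ω, F N ω k ^ p ∂μ) =O[atTop] a) :
    (fun N => ∫ ω, ‖F N ω‖ ^ p ∂μ) =O[atTop] a := by
  have pow_norm_le (v : κ → ℝ) : ‖v‖ ^ p ≤ ∑ k, v k ^ p := by
    rcases isEmpty_or_nonempty κ with _ | _
    · simp [Pi.norm_def, hp0]
    obtain ⟨k, hk⟩ := Finite.exists_max fun k => ‖v k‖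
    calc ‖v‖ ^ p ≤ ‖v k‖ ^ p := by
          gcongr
          exact (pi_norm_le_iff_of_nonneg (norm_nonneg _)).2 hk
      _ = v k ^ p := hp.pow_abs _
      _ ≤ _ := Finset.single_le_sum (fun k _ => hp.pow_nonneg (v k)) (Finset.mem_univ k)
  refine (IsBigO.of_bound 1 (Eventually.of_forall fun N => ?_)).trans
    (IsBigO.sum fun k (_ : k ∈ Finset.univ) => hFa k)
  have moments k := ((hF N k).pow p).integrable
  rw [one_mul, Real.norm_of_nonneg (integral_nonneg fun ω => by positivity), Finset.sum_apply,
    ← integral_finsetSum _ fun k _ => moments k]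
  exact (integral_mono ((HasAllMoments.norm_pi (hF N)).pow p).integrable
    (integrable_finsetSum _ fun k _ => moments k) fun ω => pow_norm_le _).trans (le_abs_self _)

end SecondMomentRates

section QuadraticForms

variable {κ κ' : Type*} [Fintype κ] [Fintype κ']

lemma dotProduct_mulVec_eq_sum (Q : Matrix κ κ' ℝ) (v : κ → ℝ) (w : κ' → ℝ) :
    v ⬝ᵥ (Q *ᵥ w) = ∑ k, ∑ l, Q k l * (v k * w l) := by
  simp only [dotProduct, Matrix.mulVec, Finset.mul_sum, mul_left_comm]

lemma abs_dotProduct_mulVec_le (Q : Matrix κ κ' ℝ) (v : κ → ℝ) (w : κ' → ℝ) :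
    |v ⬝ᵥ (Q *ᵥ w)| ≤ (∑ k, ∑ l, |Q k l|) * (‖v‖ * ‖w‖) := by
  simp only [dotProduct_mulVec_eq_sum, Finset.sum_mul]
  refine (Finset.abs_sum_le_sum_abs _ _).trans (Finset.sum_le_sum fun k _ =>
    (Finset.abs_sum_le_sum_abs _ _).trans (Finset.sum_le_sum fun l _ => ?_))
  rw [abs_mul, abs_mul]
  gcongr
  · exact norm_le_pi_norm v k
  · exact norm_le_pi_norm w l

variable {Ω : Type*} [MeasurableSpace Ω] {μ : Measure Ω} {F : Ω → κ → ℝ} {G : Ω → κ' → ℝ}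

lemma HasAllMoments.dotProduct (hF : ∀ k, HasAllMoments (fun ω => F ω k) μ) (t : κ → ℝ) :
    HasAllMoments (fun ω => t ⬝ᵥ F ω) μ :=
  .sum _ fun k _ => (hF k).const_mul (t k)

lemma HasAllMoments.dotProduct_mulVec (hF : ∀ k, HasAllMoments (fun ω => F ω k) μ)
    (hG : ∀ l, HasAllMoments (fun ω => G ω l) μ) (Q : Matrix κ κ' ℝ) :
    HasAllMoments (fun ω => F ω ⬝ᵥ (Q *ᵥ G ω)) μ := by
  simp only [dotProduct_mulVec_eq_sum]
  exact .sum _ fun k _ => .sum _ fun l _ => ((hF k).mul (hG l)).const_mul (Q k l)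

lemma integral_dotProduct (hF : ∀ k, HasAllMoments (fun ω => F ω k) μ) (t : κ → ℝ) :
    ∫ ω, t ⬝ᵥ F ω ∂μ = t ⬝ᵥ fun k => ∫ ω, F ω k ∂μ := by
  simp only [dotProduct]
  rw [integral_finsetSum _ fun k _ => ((hF k).const_mul (t k)).integrable]
  simp_rw [integral_const_mul]

lemma integral_dotProduct_mulVec (hF : ∀ k, HasAllMoments (fun ω => F ω k) μ)
    (hG : ∀ l, HasAllMoments (fun ω => G ω l) μ) (Q : Matrix κ κ' ℝ) :
    ∫ ω, F ω ⬝ᵥ (Q *ᵥ G ω) ∂μ = ∑ k, ∑ l, Q k l * ∫ ω, F ω k * G ω l ∂μ := by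
  have moments k l : HasAllMoments (fun ω => Q k l * (F ω k * G ω l)) μ :=
    ((hF k).mul (hG l)).const_mul (Q k l)
  simp only [dotProduct_mulVec_eq_sum]
  rw [integral_finsetSum _ fun k _ => (HasAllMoments.sum _ fun l _ => moments k l).integrable]
  simp_rw [integral_finsetSum _ fun l _ => (moments _ l).integrable, integral_const_mul]

end QuadraticForms

section Asymptotics

lemma one_div_sqrt_natCast_sq (N : ℕ) : (1 / √(N : ℝ)) ^ 2 = 1 / (N : ℝ) := by
  rw [div_pow, one_pow, Real.sq_sqrt N.cast_nonneg]

lemma isLittleO_one_div_sqrt_natCast_pow_three :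
    (fun N : ℕ => (1 / √(N : ℝ)) ^ 3) =o[atTop] fun N : ℕ => 1 / (N : ℝ) := by
  have vanish : (fun N : ℕ => 1 / √(N : ℝ)) =o[atTop] fun _ => (1 : ℝ) :=
    (isLittleO_one_iff ℝ).2 (Tendsto.const_div_atTop
      (Real.tendsto_sqrt_atTop.comp tendsto_natCast_atTop_atTop) 1)
  refine (vanish.mul_isBigO (isBigO_refl (fun N : ℕ => 1 / (N : ℝ)) atTop)).congr (fun N => ?_)
    fun N => one_mul _
  rw [← one_div_sqrt_natCast_sq, pow_succ' _ 2]

lemma isBigO_one_div_sqrt_natCast_pow {m n : ℕ} (hmn : m ≤ n) :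
    (fun N : ℕ => (1 / √(N : ℝ)) ^ n) =O[atTop] fun N : ℕ => (1 / √(N : ℝ)) ^ m := by
  refine IsBigO.of_bound 1 ?_
  filter_upwards [eventually_ge_atTop 1] with N hN
  have hN1 : 1 ≤ √(N : ℝ) := Real.one_le_sqrt.2 (by exact_mod_cast hN)
  rw [one_mul, Real.norm_of_nonneg (by positivity), Real.norm_of_nonneg (by positivity)]
  exact pow_le_pow_of_le_one (by positivity) ((div_le_one (by positivity)).2 hN1) hmn

namespace IsStationaryGaussianProcess

variable {Ω κ : Type*} [MeasurableSpace Ω] {μ : Measure Ω} [Fintype κ] {x : ℤ → Ω → κ → ℝ}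
  {S : ℤ → Matrix κ κ ℝ}

lemma integral_wickAverage_dotProduct_mulVec (hx : IsStationaryGaussianProcess x S μ) (m n N : ℕ)
    (Q : Matrix κ κ ℝ) :
    ∫ ω, wickAverage x (S 0).diag m N ω ⬝ᵥ (Q *ᵥ wickAverage x (S 0).diag n N ω) ∂μ
      = if m = n then lagAverage (fun τ => ∑ k, ∑ l, Q k l * (n.factorial * S τ k l ^ n)) N
        else 0 := by
  rw [integral_dotProduct_mulVec (hx.hasAllMoments_wickAverage _ m N)
    (hx.hasAllMoments_wickAverage _ n N)]
  simp_rw [hx.integral_wickAverage_mul_wickAverage]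
  split_ifs
  · simp only [lagAverage_sum, lagAverage_const_mul]
  · simp [lagAverage]

lemma variance_dotProduct_wickAverage (hx : IsStationaryGaussianProcess x S μ) (m N : ℕ)
    (t : κ → ℝ) :
    variance (fun ω => t ⬝ᵥ wickAverage x (S 0).diag (m + 1) N ω) μ
      = lagAverage (fun τ => ∑ k, ∑ l, t k * t l * ((m + 1).factorial * S τ k l ^ (m + 1))) N := by
  have := hx.isGaussianProcess.isProbabilityMeasure
  have moments := hx.hasAllMoments_wickAverage (S 0).diag (m + 1) N
  have centred : ∫ ω, t ⬝ᵥ wickAverage x (S 0).diag (m + 1) N ω ∂μ = 0 := by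
    rw [integral_dotProduct moments]
    simp only [hx.integral_wickAverage_succ, dotProduct, mul_zero, Finset.sum_const_zero]
  have square (v : κ → ℝ) : (t ⬝ᵥ v) ^ 2 = v ⬝ᵥ (Matrix.vecMulVec t t *ᵥ v) := by
    rw [Matrix.vecMulVec_mulVec, sq, dotProduct_comm t v]
    simp
  rw [variance_of_integral_eq_zero (HasAllMoments.dotProduct moments t).memLp_two.aemeasurable
    centred]
  simp_rw [square]
  rw [hx.integral_wickAverage_dotProduct_mulVec, if_pos rfl]
  simp only [Matrix.vecMulVec_apply]

section Norms

variable (hx : IsStationaryGaussianProcess x S μ) (hS : ∀ k, Summable fun τ => S τ k k ^ 2)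
include hx

lemma hasAllMoments_norm_wickAverage (s : κ → ℝ) (m N : ℕ) :
    HasAllMoments (fun ω => ‖wickAverage x s m N ω‖) μ :=
  .norm_pi (hx.hasAllMoments_wickAverage s m N)

lemma isBigO_integral_norm_wickAverage_pow (m : ℕ) {p : ℕ} (hp : Even p) (hp0 : p ≠ 0) :
    (fun N => ∫ ω, ‖wickAverage x (S 0).diag m N ω‖ ^ p ∂μ) =O[atTop] fun _ : ℕ => (1 : ℝ) :=
  have := hx.isGaussianProcess.isProbabilityMeasure
  isBigO_integral_norm_pow (hx.hasAllMoments_wickAverage _ m) hp hp0 fun k =>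
    hx.isBigO_integral_wickAverage_pow k m hp

lemma hasAllMoments_wickRemainder (N : ℕ) : HasAllMoments (fun ω => wickRemainder
    (wickAverage x (S 0).diag 2 N ω) (wickAverage x (S 0).diag 4 N ω) N) μ := by
  have := hx.isGaussianProcess.isProbabilityMeasure
  have moments m := hx.hasAllMoments_norm_wickAverage (S 0).diag m N
  exact (((moments 4).mul ((moments 2).pow 2)).add ((moments 2).pow 3)).add
    (((moments 2).pow 6).const_mul N)

include hS

lemma isBigO_integral_norm_wickAverage_sq {m : ℕ} (hm : 2 ≤ m) :
    (fun N => ∫ ω, ‖wickAverage x (S 0).diag m N ω‖ ^ 2 ∂μ)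
      =O[atTop] fun N : ℕ => (1 / √(N : ℝ)) ^ 2 := by
  have := hx.isGaussianProcess.isProbabilityMeasure
  simp_rw [one_div_sqrt_natCast_sq]
  exact isBigO_integral_norm_pow (hx.hasAllMoments_wickAverage _ m) even_two two_ne_zero fun k =>
    hx.isBigO_integral_wickAverage_sq (hS k) hm

lemma isBigO_integral_norm_wickAverage_two_pow {m : ℕ} (hm : m ≠ 0) :
    (fun N => ∫ ω, (‖wickAverage x (S 0).diag 2 N ω‖ ^ m) ^ 2 ∂μ)
      =O[atTop] fun N : ℕ => ((1 / √(N : ℝ)) ^ m) ^ 2 := by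
  have := hx.isGaussianProcess.isProbabilityMeasure
  simp_rw [pow_right_comm _ m 2, one_div_sqrt_natCast_sq, ← pow_mul]
  exact isBigO_integral_norm_pow (hx.hasAllMoments_wickAverage _ 2) (even_two_mul m)
    (mul_ne_zero two_ne_zero hm) fun k => hx.isBigO_integral_wickAverage_two_pow (hS k) m

lemma isBigO_variance_dotProduct_wickAverage {m : ℕ} (hm : 2 ≤ m) (t : κ → ℝ) :
    (fun N => variance (fun ω => t ⬝ᵥ wickAverage x (S 0).diag m N ω) μ)
      =O[atTop] fun N : ℕ => 1 / (N : ℝ) := by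
  have := hx.isGaussianProcess.isProbabilityMeasure
  simp_rw [← one_div_sqrt_natCast_sq]
  refine (IsBigO.of_bound ((∑ k, |t k|) ^ 2) (Eventually.of_forall fun N => ?_)).trans
    (hx.isBigO_integral_norm_wickAverage_sq hS hm)
  have moments := hx.hasAllMoments_wickAverage (S 0).diag m N
  rw [Real.norm_of_nonneg (variance_nonneg _ _),
    Real.norm_of_nonneg (integral_nonneg fun ω => sq_nonneg _), ← integral_const_mul]
  refine (variance_le_expectation_sq
    (HasAllMoments.dotProduct moments t).memLp_two.aestronglyMeasurable).trans ?_
  refine integral_mono ((HasAllMoments.dotProduct moments t).pow 2).integrable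
    (((hx.hasAllMoments_norm_wickAverage _ m N).pow 2).const_mul _).integrable fun ω => ?_
  rw [Pi.pow_apply, ← sq_abs, ← mul_pow]
  exact pow_le_pow_left₀ (abs_nonneg _) (abs_dotProduct_le t _) 2

lemma isBigO_integral_sq_norm_mul_norm_sq :
    (fun N => ∫ ω, (‖wickAverage x (S 0).diag 4 N ω‖ * ‖wickAverage x (S 0).diag 2 N ω‖ ^ 2) ^ 2 ∂μ)
      =O[atTop] fun N : ℕ => ((1 / √(N : ℝ)) ^ 2) ^ 2 := by
  have := hx.isGaussianProcess.isProbabilityMeasure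
  have moments m N := hx.hasAllMoments_norm_wickAverage (S 0).diag m N
  have fourth : (fun N => ∫ ω, (‖wickAverage x (S 0).diag 4 N ω‖ ^ 2) ^ 2 ∂μ)
      =O[atTop] fun _ : ℕ => (1 : ℝ) ^ 2 := by
    simp_rw [← pow_mul, one_pow]
    exact hx.isBigO_integral_norm_wickAverage_pow 4 (by decide) (by decide)
  have eighth : (fun N => ∫ ω, (‖wickAverage x (S 0).diag 2 N ω‖ ^ 4) ^ 2 ∂μ)
      =O[atTop] fun N : ℕ => ((1 / √(N : ℝ)) ^ 4) ^ 2 :=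
    hx.isBigO_integral_norm_wickAverage_two_pow hS (by decide)
  refine (isBigO_integral_mul (fun N => ((moments 4 N).pow 2).memLp_two)
    (fun N => ((moments 2 N).pow 4).memLp_two) fourth eighth).congr (fun N => ?_) fun N => ?_
  · simp_rw [mul_pow, ← pow_mul]
  · rw [one_mul, ← pow_mul]

lemma isBigO_integral_sq_norm_mul_norm :
    (fun N => ∫ ω, (‖wickAverage x (S 0).diag 4 N ω‖ * ‖wickAverage x (S 0).diag 2 N ω‖) ^ 2 ∂μ)
      =O[atTop] fun N : ℕ => (1 / √(N : ℝ)) ^ 3 := by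
  have := hx.isGaussianProcess.isProbabilityMeasure
  have moments m N := hx.hasAllMoments_norm_wickAverage (S 0).diag m N
  refine (isBigO_integral_mul (fun N => (moments 4 N).memLp_two)
    (fun N => ((moments 4 N).mul ((moments 2 N).pow 2)).memLp_two)
    (hx.isBigO_integral_norm_wickAverage_sq hS (by decide))
    (hx.isBigO_integral_sq_norm_mul_norm_sq hS)).congr (fun N => ?_) fun N => ?_
  · congr 1 with ω
    ring
  · ring

lemma isBigO_integral_sq_natCast_mul_norm_pow_six :
    (fun N : ℕ => ∫ ω, (N * ‖wickAverage x (S 0).diag 2 N ω‖ ^ 6) ^ 2 ∂μ)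
      =O[atTop] fun N : ℕ => ((1 / √(N : ℝ)) ^ 4) ^ 2 := by
  refine ((isBigO_refl (fun N : ℕ => (N : ℝ) ^ 2) atTop).mul
    (hx.isBigO_integral_norm_wickAverage_two_pow hS (m := 6) (by decide))).congr' ?_ ?_
  · exact Eventually.of_forall fun N => by simp_rw [mul_pow, integral_const_mul]
  · filter_upwards [eventually_gt_atTop 0] with N hN
    rw [pow_right_comm _ 6, pow_right_comm _ 4, one_div_sqrt_natCast_sq]
    field_simp

lemma isBigO_integral_wickRemainder :
    (fun N => ∫ ω, wickRemainder (wickAverage x (S 0).diag 2 N ω)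
      (wickAverage x (S 0).diag 4 N ω) N ∂μ) =O[atTop] fun N : ℕ => (1 / √(N : ℝ)) ^ 3 := by
  have := hx.isGaussianProcess.isProbabilityMeasure
  have moments m N := hx.hasAllMoments_norm_wickAverage (S 0).diag m N
  have sq_rate {m : ℕ} (hm : 2 ≤ m) := hx.isBigO_integral_norm_wickAverage_sq hS hm
  have pow_rate {m : ℕ} (hm : m ≠ 0) := hx.isBigO_integral_norm_wickAverage_two_pow hS hm
  have first := isBigO_integral_mul (fun N => (moments 4 N).memLp_two)
    (fun N => ((moments 2 N).pow 2).memLp_two) (sq_rate (by decide)) (pow_rate two_ne_zero)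
  have second := isBigO_integral_mul (fun N => (moments 2 N).memLp_two)
    (fun N => ((moments 2 N).pow 2).memLp_two) (sq_rate le_rfl) (pow_rate two_ne_zero)
  have third := isBigO_integral_mul (fun _ => (HasAllMoments.const (μ := μ) 1).memLp_two)
    (fun N => (((moments 2 N).pow 6).const_mul (N : ℝ)).memLp_two) (a := fun _ => 1)
    (by simpa using isBigO_refl (fun _ : ℕ => (1 : ℝ)) atTop)
    (hx.isBigO_integral_sq_natCast_mul_norm_pow_six hS)
  simp only [← pow_succ', one_mul] at first second third
  refine ((first.add second).add
    (third.trans (isBigO_one_div_sqrt_natCast_pow (by decide)))).congr_left fun N => ?_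
  rw [← integral_add, ← integral_add]
  · rfl
  · exact (((moments 4 N).mul ((moments 2 N).pow 2)).add ((moments 2 N).pow 3)).integrable
  · exact (((moments 2 N).pow 6).const_mul N).integrable
  · exact ((moments 4 N).mul ((moments 2 N).pow 2)).integrable
  · exact ((moments 2 N).pow 3).integrable

lemma isBigO_integral_wickRemainder_sq :
    (fun N => ∫ ω, wickRemainder (wickAverage x (S 0).diag 2 N ω)
      (wickAverage x (S 0).diag 4 N ω) N ^ 2 ∂μ) =O[atTop] fun N : ℕ => (1 / √(N : ℝ)) ^ 3 := by
  have := hx.isGaussianProcess.isProbabilityMeasure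
  have moments m N := hx.hasAllMoments_norm_wickAverage (S 0).diag m N
  have weaken {n : ℕ} (hn : 2 ≤ n) : (fun N : ℕ => ((1 / √(N : ℝ)) ^ n) ^ 2)
      =O[atTop] fun N : ℕ => (1 / √(N : ℝ)) ^ 3 := by
    simp_rw [← pow_mul]
    exact isBigO_one_div_sqrt_natCast_pow (by lia)
  exact isBigO_integral_sq_add
    (fun N => (((moments 4 N).mul ((moments 2 N).pow 2)).add ((moments 2 N).pow 3)).memLp_two)
    (fun N => (((moments 2 N).pow 6).const_mul (N : ℝ)).memLp_two)
    (isBigO_integral_sq_add (fun N => ((moments 4 N).mul ((moments 2 N).pow 2)).memLp_two)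
      (fun N => ((moments 2 N).pow 3).memLp_two)
      ((hx.isBigO_integral_sq_norm_mul_norm_sq hS).trans (weaken le_rfl))
      ((hx.isBigO_integral_norm_wickAverage_two_pow hS (by decide)).trans (weaken (by decide))))
    ((hx.isBigO_integral_sq_natCast_mul_norm_pow_six hS).trans (weaken (by decide)))

end Norms

end IsStationaryGaussianProcess

namespace HasWickExpansion

variable {Ω κ : Type*} [Fintype κ] {M : ℕ → Ω → ℝ} {x : ℤ → Ω → κ → ℝ} {c : ℝ} {t : κ → ℝ}
  {Q : Matrix κ κ ℝ}

lemma exists_abs_sub_le {s : κ → ℝ} (h : HasWickExpansion M x s c t Q) :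
    ∃ K L : ℝ, ∀ N ω, 1 ≤ N → |M N ω - t ⬝ᵥ wickAverage x s 4 N ω - c|
      ≤ K * wickRemainder (wickAverage x s 2 N ω) (wickAverage x s 4 N ω) N
        + L * (‖wickAverage x s 2 N ω‖ ^ 2
          + ‖wickAverage x s 4 N ω‖ * ‖wickAverage x s 2 N ω‖) := by
  obtain ⟨B, K, expansion⟩ := h
  refine ⟨K, (∑ k, ∑ l, |Q k l|) + ∑ k, ∑ l, |B k l|, fun N ω hN => ?_⟩
  have approximation := expansion N ω _ _ hN rfl rfl
  generalize wickAverage x s 2 N ω = D, wickAverage x s 4 N ω = A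
    at approximation ⊢
  have quadratic := abs_dotProduct_mulVec_le Q D D
  have mixed := abs_dotProduct_mulVec_le B D A
  have ha : 0 ≤ ∑ k, ∑ l, |Q k l| := by positivity
  have hb : 0 ≤ ∑ k, ∑ l, |B k l| := by positivity
  generalize ∑ k, ∑ l, |Q k l| = a, ∑ k, ∑ l, |B k l| = b at quadratic mixed ha hb ⊢
  have cross : 0 ≤ a * (‖A‖ * ‖D‖) + b * ‖D‖ ^ 2 := by positivity
  calc |M N ω - t ⬝ᵥ A - c|
      = |(M N ω - (c + t ⬝ᵥ A - D ⬝ᵥ (Q *ᵥ D) + D ⬝ᵥ (B *ᵥ A)))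
          + (D ⬝ᵥ (B *ᵥ A) - D ⬝ᵥ (Q *ᵥ D))| := by
        congr 1
        ring
    _ ≤ K * wickRemainder D A N + (b * (‖D‖ * ‖A‖) + a * (‖D‖ * ‖D‖)) :=
        (abs_add_le _ _).trans
          (add_le_add approximation ((abs_sub _ _).trans (add_le_add mixed quadratic)))
    _ ≤ K * wickRemainder D A N + (a + b) * (‖D‖ ^ 2 + ‖A‖ * ‖D‖) := by linarith

variable [MeasurableSpace Ω] {μ : Measure Ω} {S : ℤ → Matrix κ κ ℝ}

lemma isLittleO_integral_sub (h : HasWickExpansion M x (S 0).diag c t Q)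
    (hx : IsStationaryGaussianProcess x S μ) (hS : ∀ k, Summable fun τ => S τ k k ^ 2)
    (hM : ∀ N, Integrable (M N) μ) :
    (fun N => ∫ ω, M N ω ∂μ - (c - lagAverage (fun τ => ∑ k, ∑ l, Q k l * (2 * S τ k l ^ 2)) N))
      =o[atTop] fun N : ℕ => 1 / (N : ℝ) := by
  have := hx.isGaussianProcess.isProbabilityMeasure
  obtain ⟨B, K, expansion⟩ := h
  set W := wickAverage x (S 0).diag
  have moments m N := hx.hasAllMoments_wickAverage (S 0).diag m N
  have linear N := HasAllMoments.dotProduct (moments 4 N) t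
  have quadratic N := HasAllMoments.dotProduct_mulVec (moments 2 N) (moments 2 N) Q
  have mixed N := HasAllMoments.dotProduct_mulVec (moments 2 N) (moments 4 N) B
  have approximant N := (((HasAllMoments.const (μ := μ) c).add (linear N)).sub (quadratic N)).add
    (mixed N)
  have mean_approximant N : ∫ ω, c + t ⬝ᵥ W 4 N ω - W 2 N ω ⬝ᵥ (Q *ᵥ W 2 N ω)
      + W 2 N ω ⬝ᵥ (B *ᵥ W 4 N ω) ∂μ
      = c - lagAverage (fun τ => ∑ k, ∑ l, Q k l * (2 * S τ k l ^ 2)) N := by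
    rw [integral_add (((HasAllMoments.const c).add (linear N)).sub (quadratic N)).integrable
        (mixed N).integrable,
      integral_sub ((HasAllMoments.const c).add (linear N)).integrable (quadratic N).integrable,
      integral_add (integrable_const c) (linear N).integrable, integral_dotProduct (moments 4 N),
      hx.integral_wickAverage_dotProduct_mulVec, hx.integral_wickAverage_dotProduct_mulVec]
    simp [hx.integral_wickAverage_succ, dotProduct]
  refine (IsBigO.of_bound |K| ?_).trans_isLittleO ((hx.isBigO_integral_wickRemainder
    hS).trans_isLittleO isLittleO_one_div_sqrt_natCast_pow_three)
  filter_upwards [eventually_ge_atTop 1] with N hN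
  rw [← mean_approximant, ← integral_sub (hM N) (approximant N).integrable]
  calc _ ≤ ∫ ω, K * wickRemainder (W 2 N ω) (W 4 N ω) N ∂μ :=
        norm_integral_le_of_norm_le ((hx.hasAllMoments_wickRemainder N).const_mul K).integrable
          (ae_of_all _ fun ω => expansion N ω _ _ hN rfl rfl)
    _ ≤ _ := by
      rw [integral_const_mul, Real.norm_eq_abs, ← abs_mul]
      exact le_abs_self _

lemma isBigO_integral_sq_sub (h : HasWickExpansion M x (S 0).diag c t Q)
    (hx : IsStationaryGaussianProcess x S μ) (hS : ∀ k, Summable fun τ => S τ k k ^ 2) :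
    (fun N => ∫ ω, (M N ω - t ⬝ᵥ wickAverage x (S 0).diag 4 N ω - c) ^ 2 ∂μ)
      =O[atTop] fun N : ℕ => (1 / √(N : ℝ)) ^ 3 := by
  have := hx.isGaussianProcess.isProbabilityMeasure
  obtain ⟨K, L, abs_le⟩ := h.exists_abs_sub_le
  set W := wickAverage x (S 0).diag
  have moments m N := hx.hasAllMoments_norm_wickAverage (S 0).diag m N
  have remainder N := (hx.hasAllMoments_wickRemainder N).const_mul K
  have quadratic N := (moments 2 N).pow 2
  have mixed N := (moments 4 N).mul (moments 2 N)
  have quadratic_rate : (fun N => ∫ ω, (‖W 2 N ω‖ ^ 2) ^ 2 ∂μ)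
      =O[atTop] fun N : ℕ => (1 / √(N : ℝ)) ^ 3 := by
    refine (hx.isBigO_integral_norm_wickAverage_two_pow hS two_ne_zero).trans ?_
    simpa only [← pow_mul] using isBigO_one_div_sqrt_natCast_pow (by decide)
  have rate : (fun N => ∫ ω, (K * wickRemainder (W 2 N ω) (W 4 N ω) N
      + L * (‖W 2 N ω‖ ^ 2 + ‖W 4 N ω‖ * ‖W 2 N ω‖)) ^ 2 ∂μ)
      =O[atTop] fun N : ℕ => (1 / √(N : ℝ)) ^ 3 := by
    refine isBigO_integral_sq_add (fun N => (remainder N).memLp_two)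
      (fun N => (((quadratic N).add (mixed N)).const_mul L).memLp_two) ?_ ?_ <;>
      simp_rw [mul_pow _ _ 2, integral_const_mul] <;> refine IsBigO.const_mul_left ?_ _
    · exact hx.isBigO_integral_wickRemainder_sq hS
    · exact isBigO_integral_sq_add (fun N => (quadratic N).memLp_two)
        (fun N => (mixed N).memLp_two) quadratic_rate (hx.isBigO_integral_sq_norm_mul_norm hS)
  refine (IsBigO.of_bound 1 ?_).trans rate
  filter_upwards [eventually_ge_atTop 1] with N hN
  rw [one_mul, Real.norm_of_nonneg (integral_nonneg fun ω => sq_nonneg _),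
    Real.norm_of_nonneg (integral_nonneg fun ω => sq_nonneg _)]
  exact integral_mono_of_nonneg (ae_of_all _ fun ω => sq_nonneg _)
    (((remainder N).add (((quadratic N).add (mixed N)).const_mul L)).pow 2).integrable
    (ae_of_all _ fun ω => sq_le_sq' (neg_le_of_abs_le (abs_le N ω hN))
      (le_of_abs_le (abs_le N ω hN)))

lemma isLittleO_variance_sub (h : HasWickExpansion M x (S 0).diag c t Q)
    (hx : IsStationaryGaussianProcess x S μ) (hS : ∀ k, Summable fun τ => S τ k k ^ 2)
    (hM : ∀ N, MemLp (M N) 2 μ) :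
    (fun N => variance (M N) μ - lagAverage (fun τ => ∑ k, ∑ l, t k * t l * (24 * S τ k l ^ 4)) N)
      =o[atTop] fun N : ℕ => 1 / (N : ℝ) := by
  have := hx.isGaussianProcess.isProbabilityMeasure
  set T : ℕ → Ω → ℝ := fun N ω => t ⬝ᵥ wickAverage x (S 0).diag 4 N ω
  have hT N : MemLp (T N) 2 μ :=
    (HasAllMoments.dotProduct (hx.hasAllMoments_wickAverage _ 4 N) t).memLp_two
  have hρ N : MemLp (M N - T N) 2 μ := (hM N).sub (hT N)
  have rate : (fun N => variance (M N - T N) μ) =o[atTop] fun N : ℕ => 1 / (N : ℝ) := by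
    refine (IsBigO.of_bound 1 (Eventually.of_forall fun N => ?_)).trans_isLittleO
      ((h.isBigO_integral_sq_sub hx hS).trans_isLittleO isLittleO_one_div_sqrt_natCast_pow_three)
    rw [one_mul, Real.norm_of_nonneg (variance_nonneg _ _),
      ← variance_sub_const (hρ N).aestronglyMeasurable c]
    exact (variance_le_expectation_sq ((hρ N).sub (memLp_const c)).aestronglyMeasurable).trans
      (le_abs_self _)
  refine (isLittleO_variance_add_sub hT hρ
    (hx.isBigO_variance_dotProduct_wickAverage hS (by decide) t) rate).congr_left fun N => ?_
  rw [add_sub_cancel, hx.variance_dotProduct_wickAverage]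
  simp [Nat.factorial]

end HasWickExpansion

end Asymptotics

section Autocorrelation

variable {Ω : Type*} [MeasurableSpace Ω] {μ : Measure Ω} {y : ℤ → Ω → ℝ} {C : ℤ → ℝ} {δ p : ℕ}

/-- The lagged covariance matrices of the embedding `timeEmbedding p δ y` of a process `y` with
autocorrelation function `C`; the shift of the indices cancels in the difference `a - b`. -/
def embeddingCov (C : ℤ → ℝ) (δ p : ℕ) (τ : ℤ) : Matrix (Fin p) (Fin p) ℝ :=
  Matrix.of fun a b => C (τ * δ + (a : ℕ) - (b : ℕ))

lemma integral_timeEmbedding_mul (hC : ∀ k τ : ℤ, ∫ ω, y k ω * y (k - τ) ω ∂μ = C τ) (s t : ℤ)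
    (a b : Fin p) :
    ∫ ω, timeEmbedding p δ y s ω a * timeEmbedding p δ y t ω b ∂μ
      = embeddingCov C δ p (s - t) a b := by
  rw [embeddingCov, Matrix.of_apply, ← hC (s * δ + (a : ℕ) + 1)]
  simp only [timeEmbedding]
  congr! 4
  ring

lemma isStationaryGaussianProcess_timeEmbedding (hy : IsGaussianProcess y μ)
    (hmean : ∀ k, ∫ ω, y k ω ∂μ = 0) (hC : ∀ k τ : ℤ, ∫ ω, y k ω * y (k - τ) ω ∂μ = C τ) :
    IsStationaryGaussianProcess (timeEmbedding p δ y) (embeddingCov C δ p) μ where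
  isGaussianProcess := hy.comp_right fun q : ℤ × Fin p => q.1 * δ + (q.2 : ℕ) + 1
  integral_eq_zero _ _ := hmean _
  integral_mul := integral_timeEmbedding_mul hC

lemma autocorrelation_neg (hC : ∀ k τ : ℤ, ∫ ω, y k ω * y (k - τ) ω ∂μ = C τ) (τ : ℤ) :
    C (-τ) = C τ := by
  rw [← hC 0, ← hC τ, sub_self, zero_sub, neg_neg]
  simp_rw [mul_comm]

lemma embeddingCov_neg (hC : ∀ τ, C (-τ) = C τ) (τ : ℤ) :
    embeddingCov C δ p (-τ) = (embeddingCov C δ p τ)ᵀ := by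
  ext a b
  rw [Matrix.transpose_apply]
  simp only [embeddingCov, Matrix.of_apply]
  rw [← hC]
  congr 1
  ring

lemma summable_sq_embeddingCov (hC : ∀ k τ : ℤ, ∫ ω, y k ω * y (k - τ) ω ∂μ = C τ)
    (hmix : IsMixing μ (timeEmbedding p δ y)) (a b : Fin p) :
    Summable fun τ => embeddingCov C δ p τ a b ^ 2 := by
  have forward (a b : Fin p) : Summable fun τ : ℕ => embeddingCov C δ p τ a b ^ 2 := by
    simpa only [laggedCov, Matrix.of_apply, integral_timeEmbedding_mul hC, sub_zero, sq_abs]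
      using hmix a b
  refine .of_nat_of_neg (forward a b) ((forward b a).congr fun τ => ?_)
  rw [embeddingCov_neg (autocorrelation_neg hC), Matrix.transpose_apply]

lemma abs_autocorrelation_le (hy : ∀ k, MemLp (y k) 2 μ)
    (hC : ∀ k τ : ℤ, ∫ ω, y k ω * y (k - τ) ω ∂μ = C τ) (τ : ℤ) : |C τ| ≤ C 0 := by
  have second_moment (k : ℤ) : ∫ ω, y k ω ^ 2 ∂μ = C 0 := by simpa only [sq, sub_zero] using hC k 0
  refine abs_le_of_sq_le_sq ?_ (second_moment 0 ▸ integral_nonneg fun ω => sq_nonneg _)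
  simpa only [hC, second_moment, ← sq] using sq_integral_mul_le (hy 0) (hy (0 - τ))

end Autocorrelation

section Whitening

lemma summable_sq_mul_mul {ι κ κ' : Type*} [Fintype κ] {S : ι → Matrix κ κ ℝ}
    (hS : ∀ k l, Summable fun τ => S τ k l ^ 2) (A : Matrix κ' κ ℝ) (B : Matrix κ κ' ℝ) (k l : κ') :
    Summable fun τ => (A * S τ * B) k l ^ 2 := by
  have expand τ : (A * S τ * B) k l = ∑ q : κ × κ, (A k q.2 * B q.1 l) * S τ q.2 q.1 := by
    simp only [Matrix.mul_apply, Finset.sum_mul, Fintype.sum_prod_type, mul_right_comm]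
  have summable : Summable fun τ => ∑ q : κ × κ, S τ q.2 q.1 ^ 2 :=
    summable_sum fun q _ => hS q.2 q.1
  simp_rw [expand]
  exact (summable.mul_left (∑ q : κ × κ, (A k q.2 * B q.1 l) ^ 2)).of_nonneg_of_le
    (fun τ => sq_nonneg _) fun τ => Finset.sum_mul_sq_le_sq_mul_sq _ _ _

/-- The matrix sending a centred random vector with covariance matrix `!![a, b; b, a]` to one with
identity covariance: the sum and the difference of its coordinates, normalized. -/
noncomputable def whitening (a b : ℝ) : Matrix (Fin 2) (Fin 2) ℝ :=
  !![1 / √(2 * (a + b)), 1 / √(2 * (a + b)); 1 / √(2 * (a - b)), -(1 / √(2 * (a - b)))]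

lemma isUnit_det_whitening {a b : ℝ} (h : |b| < a) : IsUnit (whitening a b).det := by
  have hα : 0 < √(2 * (a + b)) := Real.sqrt_pos.2 (by linarith [neg_lt_of_abs_lt h])
  have hβ : 0 < √(2 * (a - b)) := Real.sqrt_pos.2 (by linarith [lt_of_abs_lt h])
  have det_eq : (whitening a b).det = -(2 / (√(2 * (a + b)) * √(2 * (a - b)))) := by
    rw [whitening, Matrix.det_fin_two_of]
    field_simp
    ring
  rw [det_eq, isUnit_iff_ne_zero, neg_ne_zero]
  positivity

lemma whitening_mul_mul_transpose {a b : ℝ} (h : |b| < a) (g₀ g₁ g₂ : ℝ) :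
    whitening a b * !![g₀, g₁; g₂, g₀] * (whitening a b)ᵀ
      = !![(2 * g₀ + g₂ + g₁) / (2 * (a + b)), (g₂ - g₁) / (2 * √(a ^ 2 - b ^ 2));
          -((g₂ - g₁) / (2 * √(a ^ 2 - b ^ 2))), (2 * g₀ - g₂ - g₁) / (2 * (a - b))] := by
  have hα : 0 < a + b := by linarith [neg_lt_of_abs_lt h]
  have hβ : 0 < a - b := by linarith [lt_of_abs_lt h]
  have hα' : √(2 * (a + b)) ^ 2 = 2 * (a + b) := Real.sq_sqrt (by positivity)
  have hβ' : √(2 * (a - b)) ^ 2 = 2 * (a - b) := Real.sq_sqrt (by positivity)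
  have hαβ : 2 * √(a ^ 2 - b ^ 2) = √(2 * (a + b)) * √(2 * (a - b)) := by
    rw [← Real.sqrt_mul (by positivity),
      show 2 * (a + b) * (2 * (a - b)) = 2 ^ 2 * (a ^ 2 - b ^ 2) by ring,
      Real.sqrt_mul (by positivity), Real.sqrt_sq zero_le_two]
  have hα₀ : √(2 * (a + b)) ≠ 0 := by positivity
  have hβ₀ : √(2 * (a - b)) ≠ 0 := by positivity
  rw [whitening, hαβ]
  generalize √(2 * (a + b)) = α, √(2 * (a - b)) = β at hα' hβ' hα₀ hβ₀ ⊢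
  rw [← hα', ← hβ']
  ext i j
  fin_cases i <;> fin_cases j <;>
    simp only [Matrix.mul_apply, Fin.sum_univ_two, Matrix.transpose_apply,
      Matrix.of_apply, Matrix.cons_val', Matrix.cons_val, Fin.mk_one, Fin.zero_eta] <;>
    field_simp <;> ring

/-- The lagged covariance matrices of the components along `directions` of the whitened planar
embedding of a process with autocorrelation function `C`. -/
noncomputable def directionalCov (C : ℤ → ℝ) (δ : ℕ) (τ : ℤ) : Matrix (Fin 5) (Fin 5) ℝ :=
  directions * (whitening (C 0) (C 1) * embeddingCov C δ 2 τ * (whitening (C 0) (C 1))ᵀ)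
    * directionsᵀ

lemma directions_mul_mul_transpose_apply (E : Matrix (Fin 2) (Fin 2) ℝ) (k l : Fin 5) :
    (directions * E * directionsᵀ) k l
      = (directions k 0 * E 0 0 + directions k 1 * E 1 0) * directions l 0
        + (directions k 0 * E 0 1 + directions k 1 * E 1 1) * directions l 1 := by
  simp only [Matrix.mul_apply, Fin.sum_univ_two, Matrix.transpose_apply]

lemma sum_traceCoeff_mul_pow_four (u v r : ℝ) :
    ∑ k, ∑ l, traceCoeff k * traceCoeff l *
        (24 * (directions * !![u, r; -r, v] * directionsᵀ) k l ^ 4)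
      = 24 * u ^ 4 + 24 * v ^ 4 + 16 * u ^ 2 * v ^ 2 + 96 * (u ^ 2 + v ^ 2) * r ^ 2
        - 64 * u * v * r ^ 2 + 64 * (r ^ 2) ^ 2 := by
  simp_rw [directions_mul_mul_transpose_apply]
  simp only [Fin.sum_univ_five, traceCoeff, directions, Matrix.of_apply, Matrix.cons_val',
    Matrix.cons_val]
  ring

lemma sum_quadraticCoeff_mul_sq_add_transpose (u v r : ℝ) :
    (∑ k, ∑ l, quadraticCoeff k l * (2 * (directions * !![u, r; -r, v] * directionsᵀ) k l ^ 2))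
        + ∑ k, ∑ l, quadraticCoeff k l * (2 * (directions * !![u, r; -r, v] * directionsᵀ)ᵀ k l ^ 2)
      = 12 * u ^ 2 + 12 * v ^ 2 + 8 * u * v := by
  simp_rw [Matrix.transpose_apply, directions_mul_mul_transpose_apply]
  simp only [Fin.sum_univ_five, quadraticCoeff, directions, Matrix.of_apply, Matrix.cons_val',
    Matrix.cons_val]
  ring

variable {C : ℤ → ℝ} {δ : ℕ}

lemma directionalCov_eq (hC : |C 1| < C 0) (τ : ℤ) :
    directionalCov C δ τ = directions *
      !![(2 * C (τ * δ) + C (τ * δ + 1) + C (τ * δ - 1)) / (2 * (C 0 + C 1)),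
          (C (τ * δ + 1) - C (τ * δ - 1)) / (2 * √(C 0 ^ 2 - C 1 ^ 2));
        -((C (τ * δ + 1) - C (τ * δ - 1)) / (2 * √(C 0 ^ 2 - C 1 ^ 2))),
          (2 * C (τ * δ) - C (τ * δ + 1) - C (τ * δ - 1)) / (2 * (C 0 - C 1))] * directionsᵀ := by
  have embeddingCov_eq : embeddingCov C δ 2 τ
      = !![C (τ * δ), C (τ * δ - 1); C (τ * δ + 1), C (τ * δ)] := by
    ext i j
    fin_cases i <;> fin_cases j <;> simp [embeddingCov]
  rw [directionalCov, embeddingCov_eq, whitening_mul_mul_transpose hC]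

lemma directionalCov_zero (hC : ∀ τ, C (-τ) = C τ) (hC₁ : |C 1| < C 0) :
    directionalCov C δ 0 = directions * directionsᵀ := by
  have hα : C 0 + C 1 ≠ 0 := by linarith [neg_lt_of_abs_lt hC₁]
  have hβ : C 0 - C 1 ≠ 0 := by linarith [lt_of_abs_lt hC₁]
  have identity : !![(2 * C 0 + C 1 + C 1) / (2 * (C 0 + C 1)), 0;
      0, (2 * C 0 - C 1 - C 1) / (2 * (C 0 - C 1))] = (1 : Matrix (Fin 2) (Fin 2) ℝ) := by
    rw [Matrix.one_fin_two]
    congr! 5 <;> field_simp <;> ring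
  rw [directionalCov_eq hC₁]
  simp only [zero_mul, zero_add, zero_sub, hC, sub_self, zero_div, neg_zero, identity,
    Matrix.mul_one]

lemma directionalCov_neg (hC : ∀ τ, C (-τ) = C τ) (τ : ℤ) :
    directionalCov C δ (-τ) = (directionalCov C δ τ)ᵀ := by
  simp only [directionalCov, embeddingCov_neg hC, Matrix.transpose_mul, Matrix.transpose_transpose,
    Matrix.mul_assoc]

lemma sum_traceCoeff_directionalCov (hC : |C 1| < C 0) (τ : ℕ) :
    ∑ k, ∑ l, traceCoeff k * traceCoeff l * (24 * directionalCov C δ τ k l ^ 4)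
      = 8 * q₂ C δ τ / (C 0 ^ 2 - C 1 ^ 2) ^ 4 := by
  have hα : 0 < C 0 + C 1 := by linarith [neg_lt_of_abs_lt hC]
  have hβ : 0 < C 0 - C 1 := by linarith [lt_of_abs_lt hC]
  have factor : C 0 ^ 2 - C 1 ^ 2 = (C 0 + C 1) * (C 0 - C 1) := sq_sub_sq _ _
  rw [directionalCov_eq hC, sum_traceCoeff_mul_pow_four, div_pow _ (2 * √_), mul_pow 2 √_,
    factor, Real.sq_sqrt (mul_pos hα hβ).le]
  simp only [q₂, q₂Poly, gammaCoeff, add_zero, ← sub_eq_add_neg]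
  generalize C (τ * δ) = g₀, C (τ * δ + 1) = g₁, C (τ * δ - 1) = g₂
  field_simp
  ring

lemma sum_traceCoeff_directionalCov_neg (hC : ∀ τ, C (-τ) = C τ) (τ : ℤ) :
    ∑ k, ∑ l, traceCoeff k * traceCoeff l * (24 * directionalCov C δ (-τ) k l ^ 4)
      = ∑ k, ∑ l, traceCoeff k * traceCoeff l * (24 * directionalCov C δ τ k l ^ 4) := by
  rw [Finset.sum_comm]
  simp only [directionalCov_neg hC, Matrix.transpose_apply, mul_comm (traceCoeff _) (traceCoeff _)]

lemma sum_quadraticCoeff_directionalCov_add_neg (hC : ∀ τ, C (-τ) = C τ) (hC₁ : |C 1| < C 0)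
    (τ : ℕ) :
    (∑ k, ∑ l, quadraticCoeff k l * (2 * directionalCov C δ τ k l ^ 2))
        + ∑ k, ∑ l, quadraticCoeff k l * (2 * directionalCov C δ (-τ) k l ^ 2)
      = 4 * q₁ C δ τ / (C 0 ^ 2 - C 1 ^ 2) ^ 2 := by
  have hα : 0 < C 0 + C 1 := by linarith [neg_lt_of_abs_lt hC₁]
  have hβ : 0 < C 0 - C 1 := by linarith [lt_of_abs_lt hC₁]
  rw [directionalCov_neg hC, directionalCov_eq hC₁, sum_quadraticCoeff_mul_sq_add_transpose,
    sq_sub_sq]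
  simp only [q₁, q₁Poly, gammaCoeff, add_zero, ← sub_eq_add_neg]
  generalize C (τ * δ) = g₀, C (τ * δ + 1) = g₁, C (τ * δ - 1) = g₂
  field_simp
  ring

lemma q₂_zero (hC : ∀ τ, C (-τ) = C τ) : q₂ C δ 0 = 8 * (C 0 ^ 2 - C 1 ^ 2) ^ 4 := by
  simp only [q₂, q₂Poly, gammaCoeff, Nat.cast_zero, zero_mul, zero_add, hC]
  ring

lemma q₁_zero (hC : ∀ τ, C (-τ) = C τ) : q₁ C δ 0 = 8 * (C 0 ^ 2 - C 1 ^ 2) ^ 2 := by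
  simp only [q₁, q₁Poly, gammaCoeff, Nat.cast_zero, zero_mul, zero_add, hC]
  ring

lemma lagAverage_sum_traceCoeff_directionalCov (hC : ∀ τ, C (-τ) = C τ) (hC₁ : |C 1| < C 0)
    (N : ℕ) :
    lagAverage (fun τ => ∑ k, ∑ l, traceCoeff k * traceCoeff l *
        (24 * directionalCov C δ τ k l ^ 4)) N
      = 64 / N + 16 / (N : ℝ) ^ 2 * ∑ τ ∈ Finset.Icc 1 (N - 1),
          ((N : ℝ) - τ) * q₂ C δ τ / (C 0 ^ 2 - C 1 ^ 2) ^ 4 := by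
  have hdet : C 0 ^ 2 - C 1 ^ 2 ≠ 0 := (sub_pos.2 (sq_lt_sq.2 (hC₁.trans_le (le_abs_self _)))).ne'
  have at_zero := sum_traceCoeff_directionalCov (δ := δ) hC₁ 0
  rw [q₂_zero hC, Nat.cast_zero] at at_zero
  simp only [lagAverage_eq, at_zero, sum_traceCoeff_directionalCov_neg hC,
    sum_traceCoeff_directionalCov hC₁, Finset.mul_sum]
  congr 1
  · field_simp
    norm_num
  · refine Finset.sum_congr rfl fun τ _ => ?_
    ring

lemma lagAverage_sum_quadraticCoeff_directionalCov (hC : ∀ τ, C (-τ) = C τ) (hC₁ : |C 1| < C 0)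
    (N : ℕ) :
    lagAverage (fun τ => ∑ k, ∑ l, quadraticCoeff k l * (2 * directionalCov C δ τ k l ^ 2)) N
      = 16 / N + 4 / (N : ℝ) ^ 2 * ∑ τ ∈ Finset.Icc 1 (N - 1),
          ((N : ℝ) - τ) * q₁ C δ τ / (C 0 ^ 2 - C 1 ^ 2) ^ 2 := by
  have hdet : C 0 ^ 2 - C 1 ^ 2 ≠ 0 := (sub_pos.2 (sq_lt_sq.2 (hC₁.trans_le (le_abs_self _)))).ne'
  have at_zero := sum_quadraticCoeff_directionalCov_add_neg (δ := δ) hC hC₁ 0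
  rw [q₁_zero hC, Nat.cast_zero, neg_zero, ← two_mul] at at_zero
  simp only [lagAverage_eq, sum_quadraticCoeff_directionalCov_add_neg hC hC₁, Finset.mul_sum]
  congr 1
  · rw [eq_div_of_mul_eq two_ne_zero ((mul_comm _ _).trans at_zero)]
    field_simp
    norm_num
  · refine Finset.sum_congr rfl fun τ _ => ?_
    ring

end Whitening

theorem mainTheorem3 {Ω : Type*} [MeasurableSpace Ω] (μ : Measure Ω) [IsProbabilityMeasure μ]
    (y : ℤ → Ω → ℝ) (C : ℤ → ℝ) (δ : ℕ) (hδ : 1 ≤ δ)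
    (hgauss : IsGaussianProcess y μ)
    (hmean : ∀ k : ℤ, ∫ ω, y k ω ∂μ = 0)
    (hC : ∀ k τ : ℤ, ∫ ω, y k ω * y (k - τ) ω ∂μ = C τ)
    (hdet : C 0 ^ 2 - C 1 ^ 2 ≠ 0)
    (hmix : IsMixing μ (timeEmbedding 2 δ y)) :
    (∀ N : ℕ, MemLp (mardiaKurtosis (timeEmbedding 2 δ y) N) 2 μ) ∧
    ((fun N : ℕ => (∫ ω, mardiaKurtosis (timeEmbedding 2 δ y) N ω ∂μ)
        - (8 - 16 / (N : ℝ)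
            - 4 / (N : ℝ) ^ 2 * ∑ τ ∈ Finset.Icc 1 (N - 1),
                ((N : ℝ) - (τ : ℝ)) * q₁ C δ τ / (C 0 ^ 2 - C 1 ^ 2) ^ 2))
      =o[atTop] fun N : ℕ => 1 / (N : ℝ)) ∧
    ((fun N : ℕ => variance (mardiaKurtosis (timeEmbedding 2 δ y) N) μ
        - (64 / (N : ℝ)
            + 16 / (N : ℝ) ^ 2 * ∑ τ ∈ Finset.Icc 1 (N - 1),
                ((N : ℝ) - (τ : ℝ)) * q₂ C δ τ / (C 0 ^ 2 - C 1 ^ 2) ^ 4))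
      =o[atTop] fun N : ℕ => 1 / (N : ℝ)) := by
  have even := autocorrelation_neg hC
  have moments k : MemLp (y k) 2 μ :=
    (hasAllMoments_of_hasGaussianLaw (hgauss.hasGaussianLaw_eval k)).memLp_two
  have hC₁ : |C 1| < C 0 := (abs_autocorrelation_le moments hC 1).lt_of_ne fun h =>
    hdet (by rw [← h, sq_abs, sub_self])
  have stationary := ((isStationaryGaussianProcess_timeEmbedding (p := 2) (δ := δ) hgauss hmean
    hC).mulVec (whitening (C 0) (C 1))).mulVec directions
  change IsStationaryGaussianProcess _ (directionalCov C δ) μ at stationary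
  have summable k : Summable fun τ => directionalCov C δ τ k k ^ 2 :=
    summable_sq_mul_mul (summable_sq_mul_mul (summable_sq_embeddingCov hC hmix) _ _) _ _ k k
  have expansion := hasWickExpansion_mardiaKurtosis fun n ω =>
    whitening (C 0) (C 1) *ᵥ timeEmbedding 2 δ y n ω
  rw [← directionalCov_zero (δ := δ) even hC₁,
    mardiaKurtosis_mulVec _ (isUnit_det_whitening hC₁)] at expansion
  have kurtosis_memLp N : MemLp (mardiaKurtosis (timeEmbedding 2 δ y) N) 2 μ :=
    memLp_mardiaKurtosis N (fun _ _ => (moments _).aemeasurable) 2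
  refine ⟨kurtosis_memLp, (expansion.isLittleO_integral_sub stationary summable fun N =>
    (kurtosis_memLp N).integrable one_le_two).congr_left fun N => ?_,
    (expansion.isLittleO_variance_sub stationary summable kurtosis_memLp).congr_left fun N => ?_⟩
  · rw [lagAverage_sum_quadraticCoeff_directionalCov even hC₁, sub_sub 8]
  · rw [lagAverage_sum_traceCoeff_directionalCov even hC₁]
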